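/- Let $\xi$ be space-time white noise on $(0,\infty)\times\mathbb R$ (a centered Gaussian process indexed by Borel sets of finite Lebesgue measure, with $\mathrm{Cov}(\xi(A),\xi(B))=|A\cap B|$), and let $Z=\{Z_t(x)\}_{t\ge0,\,x\in\mathbb R}$ be the continuous solution of the linear stochastic heat equation $\dot Z=\tfrac12 Z''+\xi$ with $Z_0=0$, i.e. $$Z_t(x)=\int_{(0,t)\times\mathbb R}p_{t-s}(y-x)\,\xi(ds\,dy)\quad\text{a.s.},\qquad p_t(x)=\frac{e^{-x^2/(2t)}}{\sqrt{2\pi t}}\qquad(t>0,\ x\in\mathbb R).$$ For $E\subseteq\mathbb R$, let $\mathrm{Dim}\,E$ denote its Barlow–Taylor macroscopic Hausdorff dimension: with $V_n=[-e^n,e^n)$ and $S_{n+1}=V_{n+1}\setminus V_n$, put $\nu^n_\rho(E)=\inf\sum_{i=1}^m (r_i/e^n)^\rho$, the infimum over all finite covers of $E\cap S_n$ by intervals $[x_i,x_i+r_i)$ with $r_i\ge1$; then $\mathrm{Dim}\,E=\inf\{\rho>0:\sum_{n\ge1}\nu^n_\rho(E)<\infty\}$. **(1)** For $t,\gamma>0$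 let $$\mathcal P_{Z_t}(\gamma)=\Big\{x\ge e^e:\ \frac{Z_t(x)}{(2\log x)^{1/2}}\ge\gamma\Big(\frac t\pi\Big)^{1/4}\Big\}.$$ If $\gamma\le1$, then $\mathcal P_{Z_t}(\gamma)$ is a.s. unbounded; if $\gamma>1$, it is a.s. bounded. For all $t>0$ and $\gamma\in(0,1]$, $\mathrm{Dim}\,\mathcal P_{Z_t}(\gamma)=1-\gamma^2$ a.s. **(2)** Let $t,c_0>0$, $X_t(x)=(\pi/t)^{1/4}Z_t(x)$, $g(x)=(2\log_+x)^{1/2}$ with $\log_+x=\max(0,\log x)$, and $\mathcal P_{X_t}(\gamma)=\{x>c_0:\ |X_t(x)|>\gamma\,g(x)\}$. Then $g$ is a gauge function for $X_t$ (it is nonnegative and nondecreasing on $[0,\infty)$, tends to $\infty$, and $\limsup_{x\to\infty}|X_t(x)|/g(x)=1$ a.s.), and the tall peaks of $X_t$ are multifractal: there are nonrandom $\gamma_1>\gamma_2>\cdots>0$ such that, almost surely, $\mathrm{Dim}\,\mathcal P_{X_t}(\gamma_i)<\mathrm{Dim}\,\mathcal P_{X_t}(\gamma_{i+1})$ for all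 $i\ge1$. In fact, $\mathrm{Dim}\,\mathcal P_{X_t}(\gamma)=1-\gamma^2$ a.s. for every $\gamma\in(0,1]$, and $\mathcal P_{X_t}(\gamma)$ is a.s. bounded for every $\gamma>1$. **(3)** $Z$ is not intermittent: for all $x\in\mathbb R$ and all real $k>0$, the moments $E(|Z_t(x)|^k)$, $t>0$, are finite and positive, and the moment Lyapunov exponent $\lambda(k)=\lim_{t\to\infty}t^{-1}\log E(|Z_t(x)|^k)$ exists and equals $0$; in particular $k\mapsto\lambda(k)/k$ is not strictly increasing on $[2,\infty)$. -/

import Mathlib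

open MeasureTheory ProbabilityTheory Filter Topology Set
open scoped ENNReal

noncomputable section

/-! ### Macroscopic Hausdorff dimension of subsets of the line -/

/-- The shells `S₀ = [-1, 1)` and `Sₙ₊₁ = [-eⁿ⁺¹, eⁿ⁺¹) \ [-eⁿ, eⁿ)`. -/
def expShell : ℕ → Set ℝ
  | 0 => Ico (-1) 1
  | n + 1 => Ico (-Real.exp (n + 1)) (Real.exp (n + 1)) \ Ico (-Real.exp n) (Real.exp n)

/-- The scaled `ρ`-dimensional Hausdorff content of `E` in the `n`th shell: the infimum of
`∑ (side Qᵢ / eⁿ) ^ ρ` over the finite covers of `E ∩ Sₙ` by boxes `Qᵢ = [xᵢ, xᵢ + rᵢ)` of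
side `rᵢ ≥ 1`. -/
def shellContent (n : ℕ) (ρ : ℝ) (E : Set ℝ) : ℝ≥0∞ :=
  ⨅ (m : ℕ) (x : Fin m → ℝ) (r : Fin m → ℝ) (_ : ∀ i, 1 ≤ r i)
    (_ : E ∩ expShell n ⊆ ⋃ i, Ico (x i) (x i + r i)),
    ∑ i, ENNReal.ofReal ((r i / Real.exp n) ^ ρ)

/-- The Barlow–Taylor macroscopic Hausdorff dimension of `E ⊆ ℝ`: the infimum of all `ρ > 0`
such that the contents over the shells `S₁, S₂, …` have a finite sum. -/
def macroDim (E : Set ℝ) : ℝ≥0∞ :=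
  ⨅ (ρ : ℝ) (_ : 0 < ρ) (_ : ∑' n : ℕ, shellContent (n + 1) ρ E < ∞), ENNReal.ofReal ρ

/-! ### Gauge functions, tall peaks, multifractality -/

/-- The tall peaks `{x ∈ ℝ₊ : ‖x‖ > c₀, |X(x)| / g(x) > γ}` of a path `X`, in the length scale
`γ`; where `g(x) = 0`, the condition is read as `|X(x)| > 0`. -/
def tallPeaks (g : ℝ → ℝ) (c₀ : ℝ) (X : ℝ → ℝ) (γ : ℝ) : Set ℝ :=
  {x | 0 ≤ x ∧ c₀ < x ∧ γ * g x < |X x|}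

/-- `g : ℝ₊ → ℝ₊` is a gauge function for the process `X` on `ℝ₊`: it is (weakly) increasing,
tends to infinity, and `limsup_{x → ∞} |X(x)| / g(x) = 1` almost surely. -/
structure IsGaugeFunction {Ω : Type*} [MeasurableSpace Ω] (P : Measure Ω)
    (X : ℝ → Ω → ℝ) (g : ℝ → ℝ) : Prop where
  nonneg : ∀ x, 0 ≤ x → 0 ≤ g x
  mono : MonotoneOn g (Ici 0)
  tendsto : Tendsto g atTop atTop
  limsup_eq : ∀ᵐ ω ∂P, limsup (fun x : ℝ => ((|X x ω| / g x : ℝ) : EReal)) atTop = 1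

/-- The tall peaks of `X`, measured by the gauge function `g`, are multifractal: there are
nonrandom length scales `γ₀ > γ₁ > ⋯ > 0` along which, almost surely, the macroscopic dimension
of the tall peaks is strictly increasing. -/
def TallPeaksMultifractal {Ω : Type*} [MeasurableSpace Ω] (P : Measure Ω)
    (X : ℝ → Ω → ℝ) (g : ℝ → ℝ) (c₀ : ℝ) : Prop :=
  IsGaugeFunction P X g ∧
  ∃ γ : ℕ → ℝ, StrictAnti γ ∧ (∀ i, 0 < γ i) ∧
    ∀ᵐ ω ∂P, ∀ i, macroDim (tallPeaks g c₀ (fun x => X x ω) (γ i)) <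
      macroDim (tallPeaks g c₀ (fun x => X x ω) (γ (i + 1)))

/-! ### White noise and the Wiener integral -/

/-- `ξ` is a white noise with control measure `μ`: a centered Gaussian process indexed by the
measurable sets of finite `μ`-measure, with `Cov(ξ(A), ξ(B)) = μ(A ∩ B)`. The values of `ξ` on
other sets are irrelevant. -/
structure IsWhiteNoise {S Ω : Type*} [MeasurableSpace S] [MeasurableSpace Ω]
    (μ : Measure S) (P : Measure Ω) (ξ : Set S → Ω → ℝ) : Prop where
  gaussian : IsGaussianProcess
    (fun A : {A : Set S // MeasurableSet A ∧ μ A < ∞} => ξ A.1) P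
  mean_zero : ∀ A, MeasurableSet A → μ A < ∞ → ∫ ω, ξ A ω ∂P = 0
  cov_eq : ∀ A B, MeasurableSet A → μ A < ∞ → MeasurableSet B → μ B < ∞ →
    cov[ξ A, ξ B; P] = μ.real (A ∩ B)

/-- The Wiener integral `∑ c · ξ(s = c)` of a simple function `s`. -/
def simpleWienerIntegral {S Ω : Type*} [MeasurableSpace S]
    (ξ : Set S → Ω → ℝ) (s : SimpleFunc S ℝ) : Ω → ℝ :=
  fun ω => ∑ c ∈ s.range, c * ξ (s ⁻¹' {c}) ω

/-- `I` is (a version of) the Wiener integral `∫ f dξ` of `f ∈ L²(μ)`: the `L²(P)`-limit of the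
integrals of simple functions that converge to `f` in `L²(μ)`. -/
def IsWienerIntegral {S Ω : Type*} [MeasurableSpace S] [MeasurableSpace Ω]
    (μ : Measure S) (P : Measure Ω) (ξ : Set S → Ω → ℝ) (f : S → ℝ) (I : Ω → ℝ) : Prop :=
  MemLp f 2 μ ∧ MemLp I 2 P ∧ ∃ s : ℕ → SimpleFunc S ℝ,
    (∀ n, MemLp (s n) 2 μ) ∧
    Tendsto (fun n => eLpNorm (fun p => s n p - f p) 2 μ) atTop (𝓝 0) ∧
    Tendsto (fun n => eLpNorm (fun ω => simpleWienerIntegral ξ (s n) ω - I ω) 2 P) atTop (𝓝 0)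

/-! ### The linear stochastic heat equation -/

/-- The heat kernel `p_t(x) = exp(-x² / (2t)) / √(2πt)` of `∂_t - ½ ∂_x²`. -/
def heatKernel (t x : ℝ) : ℝ :=
  Real.exp (-x ^ 2 / (2 * t)) / √(2 * Real.pi * t)

/-- Lebesgue measure on the space-time domain `(0, ∞) × ℝ`. -/
def spaceTimeMeasure : Measure (ℝ × ℝ) :=
  volume.restrict (Ioi 0 ×ˢ univ)

/-- `Z` is the continuous (mild, integral) solution of `∂_t Z = ½ ∂_x² Z + ξ` on `(0, ∞) × ℝ`
with `Z₀ = 0`: `Z_t(x) = ∫_{(0,t) × ℝ} p_{t-s}(y - x) ξ(ds dy)` almost surely for each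
`t > 0` and `x`, and `(t, x) ↦ Z_t(x)` is almost surely continuous. -/
structure IsLinearSHESolution {Ω : Type*} [MeasurableSpace Ω] (P : Measure Ω)
    (ξ : Set (ℝ × ℝ) → Ω → ℝ) (Z : ℝ → ℝ → Ω → ℝ) : Prop where
  initial : ∀ x, ∀ᵐ ω ∂P, Z 0 x ω = 0
  mild : ∀ t, 0 < t → ∀ x, IsWienerIntegral spaceTimeMeasure P ξ
    ((Ioo 0 t ×ˢ univ).indicator fun q : ℝ × ℝ => heatKernel (t - q.1) (q.2 - x)) (Z t x)
  continuous : ∀ᵐ ω ∂P,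
    ContinuousOn (fun q : ℝ × ℝ => Z q.1 q.2 ω) (Ici (0 : ℝ) ×ˢ univ)

/-- The peaks `{x ≥ exp(e) : Z_t(x) / (2 log x)^{1/2} ≥ γ (t/π)^{1/4}}` of a path `z = Z_t`. -/
def heatPeaks (t : ℝ) (z : ℝ → ℝ) (γ : ℝ) : Set ℝ :=
  {x | Real.exp (Real.exp 1) ≤ x ∧
    γ * (t / Real.pi) ^ (1 / 4 : ℝ) ≤ z x / √(2 * Real.log x)}

/-! ### Intermittency -/

/-- `ℓ` is the `k`th moment Lyapunov exponent `lim_{t → ∞} t⁻¹ log E(|Z_t(x)|ᵏ)` at `x`, where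
the moments are finite and positive. -/
def HasMomentLyapunov {Ω : Type*} [MeasurableSpace Ω] (P : Measure Ω)
    (Z : ℝ → ℝ → Ω → ℝ) (x k ℓ : ℝ) : Prop :=
  (∀ t, 0 < t → Integrable (fun ω => |Z t x ω| ^ k) P ∧ 0 < ∫ ω, |Z t x ω| ^ k ∂P) ∧
  Tendsto (fun t : ℝ => t⁻¹ * Real.log (∫ ω, |Z t x ω| ^ k ∂P)) atTop (𝓝 ℓ)

/-- `Z` is intermittent: the moment Lyapunov exponents `λ(k)` (at `x = 0`) exist for all real
`k > 0`, and `k ↦ λ(k) / k` is strictly increasing on `[2, ∞)`. -/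
def IsIntermittent {Ω : Type*} [MeasurableSpace Ω] (P : Measure Ω)
    (Z : ℝ → ℝ → Ω → ℝ) : Prop :=
  ∃ ℓ : ℝ → ℝ, (∀ k, 0 < k → HasMomentLyapunov P Z 0 k (ℓ k)) ∧
    StrictMonoOn (fun k => ℓ k / k) (Ici 2)

end

/-! At a fixed time, the Wiener isometry and the Chapman–Kolmogorov identity give the Gaussian field
`Z t` the covariance `heatCov t (x - y)`, with variance √(t/π). Hence X = (π/t)^{1/4} Z_t is a
standard Gaussian field with correlations at most exp(-(x-y)²/(4t)) and increments of variance
O(√|x-y|). `IsDecorrelatingField` records these facts together with path continuity, and every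
statement about peaks follows from it alone.

Over distances of order eⁿ such a field behaves like eⁿ independent standard normals, each exceeding
γ√(2n) with probability e^{-γ²n} up to powers of n. So about e^{(1-γ²)n} unit intervals of the shell
carry a peak: this gives dimension 1-γ² for γ ≤ 1, and finitely many peaks for γ > 1.

The upper bounds are first moment estimates. Chaining (`IsDecorrelatingField.exists_measure_sup_le`)
shows that the supremum over a unit interval has tail e^{-q l²} for every q < 1/2. Borel–Cantelli
then bounds the peaks for γ > 1, and summing expected contents over the shells bounds the dimension.

The lower bounds use second moments. `measureReal_inter_le_of_corr_le` replaces independence by an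
error of order the square root of the correlation, and `measureReal_biInter_compl_le` bounds the
probability that no chosen site is high. At γ = 1, slightly sparse sites make the expected number of
high sites diverge like ∑ 1/(k log k). For γ² < θ < 1, most blocks of length e^{θn} in a shell
contain a peak; counting the blocks met by one covering interval (`le_shellContent_of_blocks`) gives
dimension at least 1-θ, and θ decreases to γ².

The absolute moments scale as (t/π)^{k/4}. Growth is polynomial in t, so the Lyapunov exponents
vanish. -/

/-! ### Gaussian laws and `L²` limits -/

section Wiener

variable {S Ω : Type*} [MeasurableSpace S] [MeasurableSpace Ω]

/-- The `L²` pairing is continuous along `L²`-convergent sequences. -/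
theorem tendsto_integral_mul_of_tendsto_eLpNorm {μ : Measure S} {f g : ℕ → S → ℝ} {F G : S → ℝ}
    (hf : ∀ n, MemLp (f n) 2 μ) (hg : ∀ n, MemLp (g n) 2 μ) (hF : MemLp F 2 μ) (hG : MemLp G 2 μ)
    (hfF : Tendsto (fun n => eLpNorm (fun p => f n p - F p) 2 μ) atTop (𝓝 0))
    (hgG : Tendsto (fun n => eLpNorm (fun p => g n p - G p) 2 μ) atTop (𝓝 0)) :
    Tendsto (fun n => ∫ p, f n p * g n p ∂μ) atTop (𝓝 (∫ p, F p * G p ∂μ)) := by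
  have key : ∀ {u v : S → ℝ} (hu : MemLp u 2 μ) (hv : MemLp v 2 μ),
      inner ℝ (hu.toLp u) (hv.toLp v) = ∫ p, u p * v p ∂μ := by
    intro u v hu hv
    rw [L2.inner_def]
    refine integral_congr_ae ?_
    filter_upwards [hu.coeFn_toLp, hv.coeFn_toLp] with p h1 h2
    rw [h1, h2]
    simp [mul_comm]
  have h1 := (Lp.tendsto_Lp_iff_tendsto_eLpNorm'' f hf F hF).2 hfF
  have h2 := (Lp.tendsto_Lp_iff_tendsto_eLpNorm'' g hg G hG).2 hgG
  have h3 := h1.inner (𝕜 := ℝ) h2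
  simpa only [key] using h3

theorem tendsto_integral_of_tendsto_eLpNorm_two {P : Measure Ω} [IsProbabilityMeasure P]
    {f : ℕ → Ω → ℝ} {F : Ω → ℝ} (hf : ∀ n, MemLp (f n) 2 P) (hF : MemLp F 2 P)
    (hfF : Tendsto (fun n => eLpNorm (fun p => f n p - F p) 2 P) atTop (𝓝 0)) :
    Tendsto (fun n => ∫ p, f n p ∂P) atTop (𝓝 (∫ p, F p ∂P)) := by
  have := tendsto_integral_mul_of_tendsto_eLpNorm (g := fun _ _ => (1 : ℝ)) (G := fun _ => 1)
    hf (fun _ => memLp_const 1) hF (memLp_const 1) hfF (by simp)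
  simpa using this

/-- An `L²` limit of centered Gaussian variables is Gaussian. -/
theorem hasGaussianLaw_of_tendsto_eLpNorm {P : Measure Ω} [IsProbabilityMeasure P]
    {Y : ℕ → Ω → ℝ} {Y' : Ω → ℝ} (hY : ∀ n, HasGaussianLaw (Y n) P) (hmean : ∀ n, ∫ ω, Y n ω ∂P = 0)
    (hY' : MemLp Y' 2 P)
    (hlim : Tendsto (fun n => eLpNorm (fun ω => Y n ω - Y' ω) 2 P) atTop (𝓝 0)) :
    HasGaussianLaw Y' P := by
  have hm : ∀ n, AEMeasurable (Y n) P := fun n => (hY n).aemeasurable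
  have hm' : AEMeasurable Y' P := hY'.1.aemeasurable
  have hdist : TendstoInDistribution Y atTop Y' (fun _ => P) P := by
    refine TendstoInMeasure.tendstoInDistribution ?_ hm
    exact tendstoInMeasure_of_tendsto_eLpNorm two_ne_zero (fun n => (hm n).aestronglyMeasurable)
      hY'.1 hlim
  have hchar := ProbabilityMeasure.tendsto_iff_tendsto_charFun.1 hdist.tendsto
  have hsq := tendsto_integral_mul_of_tendsto_eLpNorm (fun n => (hY n).memLp_two)
    (fun n => (hY n).memLp_two) hY' hY' hlim hlim
  have hv : ∀ n, Var[Y n; P] = ∫ ω, Y n ω * Y n ω ∂P := by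
    intro n
    rw [variance_of_integral_eq_zero (hm n) (hmean n)]
    simp only [sq]
  have hpos : 0 ≤ ∫ ω, Y' ω * Y' ω ∂P := integral_nonneg fun ω => mul_self_nonneg _
  refine ⟨?_⟩
  -- `L²` convergence yields both convergence in distribution and convergence of the variances, so
  -- the characteristic functions exp(-σₙ²u²/2) identify the limit law.
  have : P.map Y' = gaussianReal 0 (∫ ω, Y' ω * Y' ω ∂P).toNNReal := by
    have : IsProbabilityMeasure (P.map Y') := Measure.isProbabilityMeasure_map hm'
    refine Measure.ext_of_charFun (funext fun u => ?_)
    refine tendsto_nhds_unique (hchar u) ?_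
    have : ∀ n, charFun (P.map (Y n)) u =
        Complex.exp (-(((∫ ω, Y n ω * Y n ω ∂P : ℝ) : ℂ) * u ^ 2 / 2)) := by
      intro n
      rw [(hY n).map_eq_gaussianReal, charFun_gaussianReal, hmean n,
        Real.coe_toNNReal _ (variance_nonneg _ _), hv]
      simp
    simp only [ProbabilityMeasure.coe_mk, this]
    rw [charFun_gaussianReal, Real.coe_toNNReal _ hpos]
    simp only [Complex.ofReal_zero, mul_zero, zero_mul, zero_sub]
    refine (Complex.continuous_exp.tendsto _).comp ?_
    refine Tendsto.neg ?_
    refine Tendsto.div_const (Tendsto.mul_const _ ?_) _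
    exact (Complex.continuous_ofReal.tendsto _).comp hsq
  rw [this]
  infer_instance

/-! ### The Wiener integral -/

variable {μ : Measure S} {P : Measure Ω} {ξ : Set S → Ω → ℝ}

theorem measure_preimage_singleton_lt_top_of_memLp_two {s : SimpleFunc S ℝ} (hs : MemLp s 2 μ)
    {c : ℝ} (hc : c ≠ 0) : μ (s ⁻¹' {c}) < ∞ :=
  SimpleFunc.measure_preimage_lt_top_of_memLp two_ne_zero ENNReal.ofNat_ne_top s hs c hc

/-- The Wiener integrals of simple functions form a Gaussian process. -/
theorem IsWhiteNoise.isGaussianProcess_simple (hξ : IsWhiteNoise μ P ξ) :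
    IsGaussianProcess
      (fun s : {s : SimpleFunc S ℝ // MemLp s 2 μ} => simpleWienerIntegral ξ s.1) P := by
  classical
  refine hξ.gaussian.of_isGaussianProcess fun s => ?_
  -- The zero fibre may have infinite measure and lie outside the index set; it is replaced by ∅,
  -- which is harmless because its coefficient is 0.
  let A : ℝ → {A : Set S // MeasurableSet A ∧ μ A < ∞} := fun c =>
    if hc : c ≠ 0 then ⟨s.1 ⁻¹' {c}, s.1.measurableSet_fiber c,
      measure_preimage_singleton_lt_top_of_memLp_two s.2 hc⟩ else ⟨∅, by simp⟩
  refine ⟨s.1.range.image A, ∑ c : s.1.range, (c : ℝ) • ContinuousLinearMap.proj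
    (⟨A c, Finset.mem_image_of_mem A c.2⟩ : {x // x ∈ s.1.range.image A}), fun ω => ?_⟩
  simp only [simpleWienerIntegral, _root_.sum_apply, _root_.smul_apply,
    ContinuousLinearMap.proj_apply, Finset.restrict_def, smul_eq_mul]
  rw [← Finset.sum_coe_sort]
  refine Finset.sum_congr rfl fun c _ => ?_
  by_cases hc : (c : ℝ) = 0
  · simp [hc]
  · simp [A, hc]

theorem integral_simpleWienerIntegral (hξ : IsWhiteNoise μ P ξ) {s : SimpleFunc S ℝ}
    (hs : MemLp s 2 μ) : ∫ ω, simpleWienerIntegral ξ s ω ∂P = 0 := by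
  unfold simpleWienerIntegral
  have hG : ∀ c : ℝ, c ≠ 0 → HasGaussianLaw (ξ (s ⁻¹' {c})) P := fun c hc =>
    hξ.gaussian.hasGaussianLaw_eval ⟨_, s.measurableSet_fiber c,
      measure_preimage_singleton_lt_top_of_memLp_two hs hc⟩
  rw [integral_finsetSum]
  · refine Finset.sum_eq_zero fun c _ => ?_
    by_cases hc : c = 0
    · simp [hc]
    · rw [integral_const_mul, hξ.mean_zero _ (s.measurableSet_fiber c)
        (measure_preimage_singleton_lt_top_of_memLp_two hs hc), mul_zero]
  · intro c _
    by_cases hc : c = 0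
    · simp [hc]
    · exact (hG c hc).integrable.const_mul c

/-- The Wiener isometry for simple functions. -/
theorem integral_simpleWienerIntegral_mul (hξ : IsWhiteNoise μ P ξ) {s s' : SimpleFunc S ℝ}
    (hs : MemLp s 2 μ) (hs' : MemLp s' 2 μ) :
    ∫ ω, simpleWienerIntegral ξ s ω * simpleWienerIntegral ξ s' ω ∂P = ∫ p, s p * s' p ∂μ := by
  have hL : ∀ {s : SimpleFunc S ℝ}, MemLp s 2 μ → ∀ c : ℝ, c ≠ 0 → MemLp (ξ (s ⁻¹' {c})) 2 P :=
    fun {s} hs c hc => (hξ.gaussian.hasGaussianLaw_eval ⟨_, s.measurableSet_fiber c,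
      measure_preimage_singleton_lt_top_of_memLp_two hs hc⟩).memLp_two
  have hprob := hξ.gaussian.isProbabilityMeasure
  have hpt : ∀ (s : SimpleFunc S ℝ) p,
      s p = ∑ c ∈ s.range, c * (s ⁻¹' {c}).indicator (fun _ => (1 : ℝ)) p := by
    intro s p
    rw [Finset.sum_eq_single_of_mem (s p) (s.mem_range_self p)]
    · simp
    · intro c _ hc
      rw [indicator_of_notMem (by simpa using Ne.symm hc), mul_zero]
  have hR : ∀ p, s p * s' p = ∑ c ∈ s.range, ∑ d ∈ s'.range,
      c * d * ((s ⁻¹' {c} ∩ s' ⁻¹' {d}).indicator (fun _ => (1 : ℝ)) p) := by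
    intro p
    conv_lhs => rw [hpt s p, hpt s' p, Finset.sum_mul_sum]
    refine Finset.sum_congr rfl fun c _ => Finset.sum_congr rfl fun d _ => ?_
    have h := congrFun (inter_indicator_one (M₀ := ℝ) (s := s ⁻¹' {c}) (t := s' ⁻¹' {d})) p
    simp only [Pi.mul_apply, Pi.one_def] at h
    rw [h]
    ring
  have hLs : ∀ ω, simpleWienerIntegral ξ s ω * simpleWienerIntegral ξ s' ω =
      ∑ c ∈ s.range, ∑ d ∈ s'.range, c * d * (ξ (s ⁻¹' {c}) ω * ξ (s' ⁻¹' {d}) ω) := by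
    intro ω
    unfold simpleWienerIntegral
    rw [Finset.sum_mul_sum]
    refine Finset.sum_congr rfl fun c _ => Finset.sum_congr rfl fun d _ => by ring
  simp_rw [hR, hLs]
  have hmul : ∀ c d : ℝ, Integrable (fun ω => c * d * (ξ (s ⁻¹' {c}) ω * ξ (s' ⁻¹' {d}) ω)) P := by
    intro c d
    by_cases hc : c = 0
    · simp [hc]
    by_cases hd : d = 0
    · simp [hd]
    exact ((hL hs c hc).integrable_mul (hL hs' d hd)).const_mul _
  have hind : ∀ c d : ℝ, Integrable (fun p =>
      c * d * ((s ⁻¹' {c} ∩ s' ⁻¹' {d}).indicator (fun _ => (1 : ℝ)) p)) μ := by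
    intro c d
    by_cases hc : c = 0
    · simp [hc]
    refine Integrable.const_mul ?_ _
    rw [integrable_indicator_iff ((s.measurableSet_fiber c).inter (s'.measurableSet_fiber d))]
    refine integrableOn_const ?_
    exact ((measure_mono inter_subset_left).trans_lt
      (measure_preimage_singleton_lt_top_of_memLp_two hs hc)).ne
  rw [integral_finsetSum _ (fun c _ => integrable_finsetSum _ fun d _ => hmul c d),
    integral_finsetSum _ (fun c _ => integrable_finsetSum _ fun d _ => hind c d)]
  refine Finset.sum_congr rfl fun c _ => ?_
  rw [integral_finsetSum _ (fun d _ => hmul c d), integral_finsetSum _ (fun d _ => hind c d)]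
  refine Finset.sum_congr rfl fun d _ => ?_
  by_cases hc : c = 0
  · simp [hc]
  by_cases hd : d = 0
  · simp [hd]
  have hfc := measure_preimage_singleton_lt_top_of_memLp_two hs hc
  have hfd := measure_preimage_singleton_lt_top_of_memLp_two hs' hd
  rw [integral_const_mul, integral_const_mul,
    integral_indicator_const _ ((s.measurableSet_fiber c).inter (s'.measurableSet_fiber d)),
    smul_eq_mul, mul_one, ← hξ.cov_eq _ _ (s.measurableSet_fiber c) hfc
    (s'.measurableSet_fiber d) hfd, covariance_eq_sub (hL hs c hc) (hL hs' d hd),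
    hξ.mean_zero _ (s.measurableSet_fiber c) hfc]
  simp

theorem IsWienerIntegral.integral_eq_zero (hξ : IsWhiteNoise μ P ξ) {f : S → ℝ} {I : Ω → ℝ}
    (hI : IsWienerIntegral μ P ξ f I) : ∫ ω, I ω ∂P = 0 := by
  have := hξ.gaussian.isProbabilityMeasure
  obtain ⟨-, hI2, s, hs, -, hlim⟩ := hI
  have h := tendsto_integral_of_tendsto_eLpNorm_two
    (fun n => (hξ.isGaussianProcess_simple.hasGaussianLaw_eval ⟨s n, hs n⟩).memLp_two) hI2 hlim
  refine tendsto_nhds_unique h ?_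
  simp [integral_simpleWienerIntegral hξ (hs _)]

/-- The Wiener isometry. -/
theorem IsWienerIntegral.integral_mul (hξ : IsWhiteNoise μ P ξ) {f g : S → ℝ} {I J : Ω → ℝ}
    (hI : IsWienerIntegral μ P ξ f I) (hJ : IsWienerIntegral μ P ξ g J) :
    ∫ ω, I ω * J ω ∂P = ∫ p, f p * g p ∂μ := by
  have := hξ.gaussian.isProbabilityMeasure
  obtain ⟨hf, hI2, s, hs, hsf, hsI⟩ := hI
  obtain ⟨hg, hJ2, s', hs', hsg, hsJ⟩ := hJ
  have h1 := tendsto_integral_mul_of_tendsto_eLpNorm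
    (fun n => (hξ.isGaussianProcess_simple.hasGaussianLaw_eval ⟨s n, hs n⟩).memLp_two)
    (fun n => (hξ.isGaussianProcess_simple.hasGaussianLaw_eval ⟨s' n, hs' n⟩).memLp_two)
    hI2 hJ2 hsI hsJ
  have h2 := tendsto_integral_mul_of_tendsto_eLpNorm hs hs' hf hg hsf hsg
  refine tendsto_nhds_unique h1 (h2.congr fun n => ?_)
  exact (integral_simpleWienerIntegral_mul hξ (hs n) (hs' n)).symm

/-- Wiener integrals with respect to the same white noise are jointly Gaussian. -/
theorem IsWienerIntegral.hasGaussianLaw_prodMk (hξ : IsWhiteNoise μ P ξ) {f g : S → ℝ}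
    {I J : Ω → ℝ} (hI : IsWienerIntegral μ P ξ f I) (hJ : IsWienerIntegral μ P ξ g J) :
    HasGaussianLaw (fun ω => (I ω, J ω)) P := by
  have := hξ.gaussian.isProbabilityMeasure
  obtain ⟨hf, hI2, s, hs, hsf, hsI⟩ := hI
  obtain ⟨hg, hJ2, s', hs', hsg, hsJ⟩ := hJ
  have hm : AEMeasurable (fun ω => (I ω, J ω)) P :=
    hI2.1.aemeasurable.prodMk hJ2.1.aemeasurable
  -- Cramér–Wold: joint Gaussianity is tested on linear functionals, and each of these is an `L²`
  -- limit of centered Gaussian variables.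
  refine ⟨isGaussian_of_isGaussian_map fun L => ?_⟩
  rw [AEMeasurable.map_map_of_aemeasurable (by fun_prop) hm]
  refine HasGaussianLaw.isGaussian_map ?_
  have hG : ∀ n, HasGaussianLaw (fun ω =>
      (simpleWienerIntegral ξ (s n) ω, simpleWienerIntegral ξ (s' n) ω)) P := fun n =>
    hξ.isGaussianProcess_simple.hasGaussianLaw_prodMk (s := ⟨s n, hs n⟩) (t := ⟨s' n, hs' n⟩)
  obtain ⟨α, β, hLe⟩ : ∃ α β : ℝ, ∀ a b : ℝ, L (a, b) = a * α + b * β := by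
    refine ⟨L (1, 0), L (0, 1), fun a b => ?_⟩
    have : ((a, b) : ℝ × ℝ) = a • (1, 0) + b • (0, 1) := by simp
    rw [this, map_add, map_smul, map_smul, smul_eq_mul, smul_eq_mul]
  refine hasGaussianLaw_of_tendsto_eLpNorm (fun n => (hG n).map L) (fun n => ?_) ?_ ?_
  · simp only [Function.comp_apply, hLe]
    rw [integral_add ((hG n).fst.integrable.mul_const _) ((hG n).snd.integrable.mul_const _),
      integral_mul_const, integral_mul_const, integral_simpleWienerIntegral hξ (hs n),
      integral_simpleWienerIntegral hξ (hs' n)]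
    simp
  · simp only [Function.comp_def, hLe]
    exact (hI2.mul_const _).add (hJ2.mul_const _)
  · simp only [Function.comp_def, hLe]
    have h1 : Tendsto (fun n =>
        eLpNorm (fun ω => α * (simpleWienerIntegral ξ (s n) ω - I ω)) 2 P
        + eLpNorm (fun ω => β * (simpleWienerIntegral ξ (s' n) ω - J ω)) 2 P) atTop (𝓝 0) := by
      have e : ∀ (c : ℝ) (h : Ω → ℝ), eLpNorm (fun ω => c * h ω) 2 P = ‖c‖ₑ * eLpNorm h 2 P :=
        fun c h => eLpNorm_const_smul c h 2 P
      simp only [e]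
      simpa using (ENNReal.Tendsto.const_mul hsI (Or.inr enorm_ne_top)).add
        (ENNReal.Tendsto.const_mul hsJ (Or.inr enorm_ne_top))
    refine tendsto_of_tendsto_of_tendsto_of_le_of_le tendsto_const_nhds h1 (fun _ => zero_le)
      fun n => ?_
    have hA : AEStronglyMeasurable
        (fun ω => α * (simpleWienerIntegral ξ (s n) ω - I ω)) P :=
      (((hG n).fst.memLp_two.sub hI2).const_mul _).1
    have hB : AEStronglyMeasurable
        (fun ω => β * (simpleWienerIntegral ξ (s' n) ω - J ω)) P :=
      (((hG n).snd.memLp_two.sub hJ2).const_mul _).1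
    refine le_trans (le_of_eq ?_) (eLpNorm_add_le hA hB one_le_two)
    congr 1
    ext ω
    simp only [Pi.add_apply]
    ring

end Wiener

/-! ### Covariance of the linear stochastic heat equation -/

section HeatKernel

theorem heatKernel_nonneg (t x : ℝ) : 0 ≤ heatKernel t x := by
  unfold heatKernel; positivity

/-- The Chapman–Kolmogorov identity for the heat kernel at equal times. -/
theorem integral_heatKernel_mul {s : ℝ} (hs : 0 < s) (x y : ℝ) :
    ∫ z, heatKernel s (z - x) * heatKernel s (z - y) = heatKernel (2 * s) (x - y) := by
  -- Completing the square around the midpoint of x and y.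
  have hpt : ∀ z, heatKernel s (z - x) * heatKernel s (z - y) =
      Real.exp (-(1 / s) * (z - (x + y) / 2) ^ 2) *
        (Real.exp (-(x - y) ^ 2 / (2 * (2 * s))) / (2 * Real.pi * s)) := by
    intro z
    unfold heatKernel
    rw [div_mul_div_comm, Real.mul_self_sqrt (by positivity), ← Real.exp_add, mul_div_assoc',
      ← Real.exp_add]
    congr 2
    field_simp
    ring
  simp_rw [hpt]
  rw [integral_mul_const, integral_sub_right_eq_self (fun z : ℝ => Real.exp (-(1 / s) * z ^ 2)),
    integral_gaussian]
  unfold heatKernel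
  have h1 : √(Real.pi / (1 / s)) = √(Real.pi * s) := by congr 1; field_simp
  have h2 : √(2 * Real.pi * (2 * s)) = 2 * √(Real.pi * s) := by
    rw [show 2 * Real.pi * (2 * s) = 2 ^ 2 * (Real.pi * s) by ring, Real.sqrt_mul (by positivity),
      Real.sqrt_sq (by norm_num)]
  have h3 : 2 * Real.pi * s = 2 * (√(Real.pi * s) * √(Real.pi * s)) := by
    rw [Real.mul_self_sqrt (by positivity)]; ring
  have h4 : 0 < √(Real.pi * s) := by positivity
  rw [h1, h2, h3]
  field_simp

/-! ### The spatial covariance at a fixed time and its estimates -/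

/-- The covariance function `∫₀ᵗ p_{2s}(h) ds` of the solution of the linear stochastic heat
equation at time `t`. -/
noncomputable def heatCov (t h : ℝ) : ℝ := ∫ s in (0 : ℝ)..t, heatKernel (2 * s) h

theorem heatKernel_two_mul_zero (s : ℝ) (hs : 0 ≤ s) :
    heatKernel (2 * s) 0 = (2 * √Real.pi)⁻¹ * s ^ (-(1 / 2) : ℝ) := by
  unfold heatKernel
  rw [show 2 * Real.pi * (2 * s) = 2 ^ 2 * (Real.pi * s) by ring, Real.sqrt_mul (by positivity),
      Real.sqrt_sq (by norm_num), Real.sqrt_mul Real.pi_pos.le, Real.rpow_neg hs,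
      ← Real.sqrt_eq_rpow]
  simp
  ring

theorem heatKernel_two_mul (s h : ℝ) :
    heatKernel (2 * s) h = Real.exp (-(h ^ 2 / (4 * s))) * heatKernel (2 * s) 0 := by
  unfold heatKernel
  rw [show -h ^ 2 / (2 * (2 * s)) = -(h ^ 2 / (4 * s)) by ring]
  simp
  ring

theorem intervalIntegrable_heatKernel_zero {t : ℝ} (ht : 0 < t) :
    IntervalIntegrable (fun s => heatKernel (2 * s) 0) volume 0 t := by
  have h : IntervalIntegrable (fun s : ℝ => (2 * √Real.pi)⁻¹ * s ^ (-(1 / 2) : ℝ)) volume 0 t :=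
    (intervalIntegral.intervalIntegrable_rpow' (by norm_num)).const_mul _
  refine h.congr fun s hs => ?_
  rw [uIoc_of_le ht.le] at hs
  exact (heatKernel_two_mul_zero s hs.1.le).symm

theorem measurable_heatKernel_two_mul (h : ℝ) : Measurable fun s => heatKernel (2 * s) h := by
  unfold heatKernel
  fun_prop

theorem intervalIntegrable_heatKernel {t : ℝ} (ht : 0 < t) (h : ℝ) :
    IntervalIntegrable (fun s => heatKernel (2 * s) h) volume 0 t := by
  refine (intervalIntegrable_heatKernel_zero ht).mono_fun
    (measurable_heatKernel_two_mul h).aestronglyMeasurable ?_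
  rw [uIoc_of_le ht.le]
  filter_upwards [ae_restrict_mem measurableSet_Ioc] with s hs
  rw [Real.norm_of_nonneg (heatKernel_nonneg _ _), Real.norm_of_nonneg (heatKernel_nonneg _ _),
    heatKernel_two_mul]
  refine mul_le_of_le_one_left (heatKernel_nonneg _ _) (Real.exp_le_one_iff.2 ?_)
  have := hs.1
  exact neg_nonpos.2 (by positivity)

/-- This variance is the source of the normalisation (π/t)^{1/4}. -/
theorem heatCov_zero {t : ℝ} (ht : 0 < t) : heatCov t 0 = √(t / Real.pi) := by
  unfold heatCov
  have : ∫ s in (0 : ℝ)..t, heatKernel (2 * s) 0 =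
      ∫ s in (0 : ℝ)..t, (2 * √Real.pi)⁻¹ * s ^ (-(1 / 2) : ℝ) := by
    refine intervalIntegral.integral_congr fun s hs => ?_
    rw [uIcc_of_le ht.le] at hs
    exact heatKernel_two_mul_zero s hs.1
  rw [this, intervalIntegral.integral_const_mul, integral_rpow (Or.inl (by norm_num)),
    Real.sqrt_div ht.le, Real.sqrt_eq_rpow t]
  have : 0 < √Real.pi := by positivity
  norm_num
  field_simp

theorem heatCov_nonneg {t : ℝ} (ht : 0 < t) (h : ℝ) : 0 ≤ heatCov t h :=
  intervalIntegral.integral_nonneg ht.le fun _ _ => heatKernel_nonneg _ _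

/-- In the integrand the factor exp(-h²/(4s)) is largest at s = t, so it can be pulled out there.
This is the Gaussian decay of correlations. -/
theorem heatCov_le {t : ℝ} (ht : 0 < t) (h : ℝ) :
    heatCov t h ≤ Real.exp (-(h ^ 2 / (4 * t))) * heatCov t 0 := by
  unfold heatCov
  rw [← intervalIntegral.integral_const_mul]
  refine intervalIntegral.integral_mono_on_of_le_Ioo ht.le (intervalIntegrable_heatKernel ht h)
    ((intervalIntegrable_heatKernel_zero ht).const_mul _) fun s hs => ?_
  rw [heatKernel_two_mul]
  refine mul_le_mul_of_nonneg_right (Real.exp_le_exp.2 (neg_le_neg ?_)) (heatKernel_nonneg _ _)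
  have := hs.1
  have := hs.2
  gcongr

/-- The power 1/4 is tuned to u = h²/(4s): it produces √|h| and a singularity s^{-1/4}, which
together with the s^{-1/2} of the kernel is still integrable at 0. -/
theorem one_sub_exp_neg_le_rpow {u : ℝ} (hu : 0 ≤ u) :
    1 - Real.exp (-u) ≤ u ^ (1 / 4 : ℝ) := by
  rcases le_total u 1 with h | h
  · have h1 := Real.add_one_le_exp (-u)
    have h2 : u ≤ u ^ (1 / 4 : ℝ) := by
      conv_lhs => rw [← Real.rpow_one u]
      exact Real.rpow_le_rpow_of_exponent_ge_of_imp hu h (by norm_num) (fun _ h => by norm_num at h)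
    linarith
  · have h1 := Real.exp_pos (-u)
    have h2 := Real.one_le_rpow h (show (0 : ℝ) ≤ 1 / 4 by norm_num)
    linarith

theorem heatCov_zero_sub_le {t : ℝ} (ht : 0 < t) (h : ℝ) :
    heatCov t 0 - heatCov t h ≤ 4 * t ^ (1 / 4 : ℝ) * √|h| := by
  unfold heatCov
  rw [← intervalIntegral.integral_sub (intervalIntegrable_heatKernel_zero ht)
    (intervalIntegrable_heatKernel ht h)]
  have hint : ∫ s in (0 : ℝ)..t, √|h| * s ^ (-(3 / 4) : ℝ) = 4 * t ^ (1 / 4 : ℝ) * √|h| := by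
    rw [intervalIntegral.integral_const_mul, integral_rpow (Or.inl (by norm_num))]
    norm_num
    ring
  rw [← hint]
  refine intervalIntegral.integral_mono_on_of_le_Ioo ht.le
    ((intervalIntegrable_heatKernel_zero ht).sub (intervalIntegrable_heatKernel ht h))
    ((intervalIntegral.intervalIntegrable_rpow' (by norm_num)).const_mul _) fun s hs => ?_
  have hs0 := hs.1
  rw [heatKernel_two_mul s h, ← one_sub_mul, heatKernel_two_mul_zero s hs0.le]
  have h1 := one_sub_exp_neg_le_rpow (u := h ^ 2 / (4 * s)) (by positivity)
  have h2 : (h ^ 2 / (4 * s)) ^ (1 / 4 : ℝ) ≤ √|h| * s ^ (-(1 / 4) : ℝ) := by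
    rw [Real.div_rpow (by positivity) (by positivity), div_eq_mul_inv, ← sq_abs,
      ← Real.rpow_natCast_mul (abs_nonneg h), Real.sqrt_eq_rpow, Real.rpow_neg hs0.le]
    norm_num
    gcongr
    linarith
  have h3 : (2 * √Real.pi)⁻¹ ≤ 1 := by
    refine inv_le_one_of_one_le₀ ?_
    have : 1 ≤ √Real.pi := Real.one_le_sqrt.2 (by linarith [Real.pi_gt_three])
    linarith
  calc (1 - Real.exp (-(h ^ 2 / (4 * s)))) * ((2 * √Real.pi)⁻¹ * s ^ (-(1 / 2) : ℝ))
      ≤ (√|h| * s ^ (-(1 / 4) : ℝ)) * (1 * s ^ (-(1 / 2) : ℝ)) := by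
        gcongr
        exact h1.trans h2
    _ = √|h| * s ^ (-(3 / 4) : ℝ) := by
        rw [one_mul, mul_assoc, ← Real.rpow_add hs0]
        norm_num

/-- The `L²` pairing of the heat kernels that define the mild solution at time `t`. -/
theorem integral_indicator_heatKernel_mul {t : ℝ} (ht : 0 < t) (x y : ℝ)
    (hx : MemLp ((Ioo 0 t ×ˢ univ).indicator fun q : ℝ × ℝ => heatKernel (t - q.1) (q.2 - x)) 2
      spaceTimeMeasure)
    (hy : MemLp ((Ioo 0 t ×ˢ univ).indicator fun q : ℝ × ℝ => heatKernel (t - q.1) (q.2 - y)) 2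
      spaceTimeMeasure) :
    ∫ q, ((Ioo 0 t ×ˢ univ).indicator fun q : ℝ × ℝ => heatKernel (t - q.1) (q.2 - x)) q *
      ((Ioo 0 t ×ˢ univ).indicator fun q : ℝ × ℝ => heatKernel (t - q.1) (q.2 - y)) q
      ∂spaceTimeMeasure = heatCov t (x - y) := by
  have hint := hx.integrable_mul hy
  -- With the measure in product form, Fubini reduces the spatial integral to Chapman–Kolmogorov,
  -- and s ↦ t - s turns the time integral into `heatCov`.
  have hμ : spaceTimeMeasure = (volume.restrict (Ioi (0 : ℝ))).prod volume := by
    unfold spaceTimeMeasure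
    rw [Measure.volume_eq_prod, ← Measure.prod_restrict, Measure.restrict_univ]
  rw [hμ] at hint ⊢
  simp only [Pi.mul_def] at hint
  rw [integral_prod _ hint]
  have hpt : ∀ s : ℝ, ∫ z : ℝ,
      ((Ioo 0 t ×ˢ univ).indicator fun q : ℝ × ℝ => heatKernel (t - q.1) (q.2 - x)) (s, z) *
      ((Ioo 0 t ×ˢ univ).indicator fun q : ℝ × ℝ => heatKernel (t - q.1) (q.2 - y)) (s, z) =
      (Ioo 0 t).indicator (fun s => heatKernel (2 * (t - s)) (x - y)) s := by
    intro s
    by_cases hs : s ∈ Ioo 0 t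
    · rw [indicator_of_mem hs, ← integral_heatKernel_mul (sub_pos.2 hs.2)]
      refine integral_congr_ae (ae_of_all _ fun z => ?_)
      simp [indicator_of_mem (show (s, z) ∈ Ioo 0 t ×ˢ univ from ⟨hs, mem_univ _⟩)]
    · rw [indicator_of_notMem hs]
      have : ∀ z : ℝ, (s, z) ∉ Ioo 0 t ×ˢ (univ : Set ℝ) := fun z h => hs h.1
      simp [indicator_of_notMem (this _)]
  simp_rw [hpt]
  rw [integral_indicator measurableSet_Ioo, Measure.restrict_restrict measurableSet_Ioo,
    inter_eq_left.2 (fun s hs => hs.1), ← integral_Ioc_eq_integral_Ioo,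
    ← intervalIntegral.integral_of_le ht.le,
    intervalIntegral.integral_comp_sub_left (fun s => heatKernel (2 * s) (x - y)) t]
  simp [heatCov]

end HeatKernel

/-! ### Standardised Gaussian fields with fast decorrelation -/

/-- A centered Gaussian field on the line with unit variance, Gaussian decay of correlations,
Hölder increments and continuous sample paths. -/
structure IsDecorrelatingField {Ω : Type*} [MeasurableSpace Ω] (P : Measure Ω)
    (X : ℝ → Ω → ℝ) (c K : ℝ) : Prop where
  gaussian : ∀ x y, HasGaussianLaw (fun ω => (X x ω, X y ω)) P
  mean : ∀ x, ∫ ω, X x ω ∂P = 0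
  sq : ∀ x, ∫ ω, X x ω ^ 2 ∂P = 1
  corr_le : ∀ x y, |∫ ω, X x ω * X y ω ∂P| ≤ Real.exp (-(c * (x - y) ^ 2))
  incr_le : ∀ x y, ∫ ω, (X x ω - X y ω) ^ 2 ∂P ≤ K * √|x - y|
  continuous : ∀ᵐ ω ∂P, Continuous fun x => X x ω

/-- The standardised solution of the linear stochastic heat equation at a fixed time. -/
theorem IsLinearSHESolution.isDecorrelatingField {Ω : Type*} [MeasurableSpace Ω] {P : Measure Ω}
    {ξ : Set (ℝ × ℝ) → Ω → ℝ} (hξ : IsWhiteNoise spaceTimeMeasure P ξ)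
    {Z : ℝ → ℝ → Ω → ℝ} (hZ : IsLinearSHESolution P ξ Z) {t : ℝ} (ht : 0 < t) :
    IsDecorrelatingField P (fun x ω => (Real.pi / t) ^ (1 / 4 : ℝ) * Z t x ω) (1 / (4 * t))
      (2 * √(Real.pi / t) * (4 * t ^ (1 / 4 : ℝ))) := by
  have hκ0 : 0 ≤ (Real.pi / t) ^ (1 / 4 : ℝ) := by positivity
  have hκ : (Real.pi / t) ^ (1 / 4 : ℝ) * (Real.pi / t) ^ (1 / 4 : ℝ) = √(Real.pi / t) := by
    rw [← Real.rpow_add (by positivity), Real.sqrt_eq_rpow]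
    norm_num
  have hv : √(Real.pi / t) * heatCov t 0 = 1 := by
    rw [heatCov_zero ht, ← Real.sqrt_mul (by positivity)]
    have := Real.pi_pos
    rw [show Real.pi / t * (t / Real.pi) = 1 by field_simp, Real.sqrt_one]
  have hmul : ∀ x y, ∫ ω, (Real.pi / t) ^ (1 / 4 : ℝ) * Z t x ω *
      ((Real.pi / t) ^ (1 / 4 : ℝ) * Z t y ω) ∂P = √(Real.pi / t) * heatCov t (x - y) := by
    intro x y
    have : ∀ a b : ℝ, (Real.pi / t) ^ (1 / 4 : ℝ) * a * ((Real.pi / t) ^ (1 / 4 : ℝ) * b) =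
        √(Real.pi / t) * (a * b) := fun a b => by rw [mul_mul_mul_comm, hκ]
    simp only [this]
    rw [integral_const_mul, (hZ.mild t ht x).integral_mul hξ (hZ.mild t ht y),
      integral_indicator_heatKernel_mul ht x y (hZ.mild t ht x).1 (hZ.mild t ht y).1]
  have hL : ∀ x, MemLp (fun ω => (Real.pi / t) ^ (1 / 4 : ℝ) * Z t x ω) 2 P := fun x =>
    (hZ.mild t ht x).2.1.const_mul _
  constructor
  · intro x y
    have h := ((hZ.mild t ht x).hasGaussianLaw_prodMk hξ (hZ.mild t ht y)).fun_smul
      ((Real.pi / t) ^ (1 / 4 : ℝ))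
    simpa using h
  · intro x
    rw [integral_const_mul, (hZ.mild t ht x).integral_eq_zero hξ, mul_zero]
  · intro x
    simp_rw [pow_two]
    rw [hmul, sub_self, hv]
  · intro x y
    rw [hmul, abs_of_nonneg (mul_nonneg (Real.sqrt_nonneg _) (heatCov_nonneg ht _))]
    calc √(Real.pi / t) * heatCov t (x - y)
        ≤ √(Real.pi / t) * (Real.exp (-((x - y) ^ 2 / (4 * t))) * heatCov t 0) := by
          gcongr; exact heatCov_le ht _
      _ = Real.exp (-((x - y) ^ 2 / (4 * t))) * (√(Real.pi / t) * heatCov t 0) := by ring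
      _ = _ := by rw [hv, mul_one]; congr 2; ring
  · intro x y
    -- The increment variance is 2√(π/t)(C(0) - C(x-y)) with C = `heatCov t`, whence the constant in
    -- the statement.
    have hexp : ∀ ω, ((Real.pi / t) ^ (1 / 4 : ℝ) * Z t x ω -
        (Real.pi / t) ^ (1 / 4 : ℝ) * Z t y ω) ^ 2 =
        (Real.pi / t) ^ (1 / 4 : ℝ) * Z t x ω * ((Real.pi / t) ^ (1 / 4 : ℝ) * Z t x ω) -
        2 * ((Real.pi / t) ^ (1 / 4 : ℝ) * Z t x ω * ((Real.pi / t) ^ (1 / 4 : ℝ) * Z t y ω)) +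
        (Real.pi / t) ^ (1 / 4 : ℝ) * Z t y ω * ((Real.pi / t) ^ (1 / 4 : ℝ) * Z t y ω) :=
      fun ω => by ring
    simp_rw [hexp]
    have i1 := (hL x).integrable_mul (hL x)
    have i2 := ((hL x).integrable_mul (hL y)).const_mul 2
    have i3 := (hL y).integrable_mul (hL y)
    simp only [Pi.mul_apply] at i2
    rw [integral_add (by exact i1.sub i2) (by exact i3), integral_sub (by exact i1) i2,
      integral_const_mul, hmul, hmul, hmul, sub_self, sub_self]
    have h := heatCov_zero_sub_le ht (x - y)
    have h' := mul_le_mul_of_nonneg_left h (Real.sqrt_nonneg (Real.pi / t))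
    linarith
  · filter_upwards [hZ.continuous] with ω hω
    refine continuous_const.mul ?_
    have := hω.comp_continuous (f := fun x : ℝ => (t, x)) (by fun_prop)
      (fun x => ⟨ht.le, mem_univ _⟩)
    exact this

/-! ### Gaussian tails and decorrelation -/

section Tails

variable {Ω : Type*} [MeasurableSpace Ω] {P : Measure Ω}

theorem HasGaussianLaw.map_eq_of_integral {Y : Ω → ℝ} (hY : HasGaussianLaw Y P)
    (hmean : ∫ ω, Y ω ∂P = 0) :
    P.map Y = gaussianReal 0 (∫ ω, Y ω ^ 2 ∂P).toNNReal := by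
  rw [hY.map_eq_gaussianReal, hmean, variance_of_integral_eq_zero hY.aemeasurable hmean]

theorem HasGaussianLaw.hasSubgaussianMGF {Y : Ω → ℝ} (hY : HasGaussianLaw Y P)
    (hmean : ∫ ω, Y ω ∂P = 0) {v : ℝ} (hv : ∫ ω, Y ω ^ 2 ∂P ≤ v) :
    HasSubgaussianMGF Y v.toNNReal P := by
  have hmap := HasGaussianLaw.map_eq_of_integral hY hmean
  constructor
  · intro t
    have := integrable_exp_mul_gaussianReal (μ := 0) (v := (∫ ω, Y ω ^ 2 ∂P).toNNReal) t
    rw [← hmap] at this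
    exact this.comp_aemeasurable hY.aemeasurable
  · intro t
    rw [mgf_gaussianReal hmap, Real.exp_le_exp, zero_mul, zero_add]
    gcongr

/-- The sub-Gaussian tail bound for a centered Gaussian variable of variance at most `v`. -/
theorem HasGaussianLaw.measureReal_le_abs {Y : Ω → ℝ} (hY : HasGaussianLaw Y P)
    (hmean : ∫ ω, Y ω ∂P = 0) {v : ℝ} (hv0 : 0 ≤ v) (hv : ∫ ω, Y ω ^ 2 ∂P ≤ v) {a : ℝ}
    (ha : 0 ≤ a) : P.real {ω | a ≤ |Y ω|} ≤ 2 * Real.exp (-a ^ 2 / (2 * v)) := by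
  have := hY.isProbabilityMeasure
  have hS := HasGaussianLaw.hasSubgaussianMGF hY hmean hv
  have h1 := hS.measure_ge_le ha
  have h2 := hS.neg.measure_ge_le ha
  rw [Real.coe_toNNReal _ hv0] at h1 h2
  have hsub : {ω | a ≤ |Y ω|} ⊆ {ω | a ≤ Y ω} ∪ {ω | a ≤ (-Y) ω} := by
    intro ω hω
    rcases le_abs.1 (show a ≤ |Y ω| from hω) with h | h
    · exact Or.inl h
    · exact Or.inr h
  have h3 := (measureReal_mono hsub (by finiteness)).trans
    (measureReal_union_le (μ := P) {ω | a ≤ Y ω} {ω | a ≤ (-Y) ω})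
  linarith

theorem gaussianPDFReal_zero_one (x : ℝ) :
    gaussianPDFReal 0 1 x = (√(2 * Real.pi))⁻¹ * Real.exp (-x ^ 2 / 2) := by
  simp [gaussianPDFReal]

/-- A lower bound of Mills ratio type. -/
theorem exists_le_gaussianReal_Ici : ∃ c : ℝ, 0 < c ∧ ∀ a : ℝ, 1 ≤ a →
    c / a * Real.exp (-a ^ 2 / 2) ≤ (gaussianReal 0 1).real (Ici a) := by
  -- Only the mass of [a, a + 1/a] is kept. There x² ≤ a² + 3, which costs e^{-3/2}, and the length
  -- supplies the factor 1/a.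
  refine ⟨(√(2 * Real.pi))⁻¹ * Real.exp (-(3 / 2)), by positivity, fun a ha => ?_⟩
  have ha0 : 0 < a := by linarith
  have hsub : Icc a (a + 1 / a) ⊆ Ici a := fun x hx => hx.1
  refine le_trans ?_ (measureReal_mono hsub (by finiteness))
  rw [measureReal_def, gaussianReal_apply_eq_integral 0 one_ne_zero,
    ENNReal.toReal_ofReal (integral_nonneg fun x => gaussianPDFReal_nonneg _ _ _)]
  have hconst : ∫ _x in Icc a (a + 1 / a), (√(2 * Real.pi))⁻¹ * Real.exp (-(3 / 2)) *
      Real.exp (-a ^ 2 / 2) = (√(2 * Real.pi))⁻¹ * Real.exp (-(3 / 2)) / a *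
      Real.exp (-a ^ 2 / 2) := by
    rw [setIntegral_const, measureReal_def, Real.volume_Icc, smul_eq_mul,
      ENNReal.toReal_ofReal (by rw [add_sub_cancel_left]; positivity)]
    field_simp
    ring
  rw [← hconst]
  refine setIntegral_mono_on (integrableOn_const (by simp))
    (integrable_gaussianPDFReal 0 1).integrableOn measurableSet_Icc fun x hx => ?_
  rw [gaussianPDFReal_zero_one, mul_assoc, ← Real.exp_add]
  refine mul_le_mul_of_nonneg_left (Real.exp_le_exp.2 ?_) (by positivity)
  have h1 : x ^ 2 ≤ (a + 1 / a) ^ 2 := pow_le_pow_left₀ (by linarith [hx.1]) hx.2 2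
  have h2 : (a + 1 / a) ^ 2 = a ^ 2 + 2 + (1 / a) ^ 2 := by field_simp; ring
  have h3 : (1 / a) ^ 2 ≤ 1 := pow_le_one₀ (by positivity) (by rw [div_le_one ha0]; exact ha)
  linarith

/-- The standard normal density is at most 1, so lowering a threshold by d adds at most d to the
tail. -/
theorem gaussianReal_Ici_sub_le (b : ℝ) {d : ℝ} (hd : 0 ≤ d) :
    (gaussianReal 0 1).real (Ici (b - d)) ≤ (gaussianReal 0 1).real (Ici b) + d := by
  have hsub : Ici (b - d) ⊆ Ici b ∪ Ico (b - d) b := by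
    intro x hx
    rcases le_or_gt b x with h | h
    · exact Or.inl h
    · exact Or.inr ⟨hx, h⟩
  refine (measureReal_mono hsub (by finiteness)).trans ((measureReal_union_le _ _).trans ?_)
  gcongr
  rw [measureReal_def, gaussianReal_apply_eq_integral 0 one_ne_zero,
    ENNReal.toReal_ofReal (integral_nonneg fun x => gaussianPDFReal_nonneg _ _ _)]
  have hconst : ∫ _x in Ico (b - d) b, (1 : ℝ) = d := by
    simp [measureReal_def, hd]
  refine le_of_le_of_eq ?_ hconst
  refine setIntegral_mono_on (integrable_gaussianPDFReal 0 1).integrableOn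
    (integrableOn_const (by simp)) measurableSet_Ico fun x hx => ?_
  rw [gaussianPDFReal_zero_one]
  refine mul_le_one₀ (inv_le_one_of_one_le₀ (Real.one_le_sqrt.2 ?_)) (by positivity)
    (Real.exp_le_one_iff.2 (by nlinarith [sq_nonneg x]))
  linarith [Real.pi_gt_three]

/-! ### Near independence and the second moment method -/

/-- Weakly correlated standard Gaussian variables have nearly independent upper tails. -/
theorem measureReal_inter_le_of_corr_le {X Y : Ω → ℝ}
    (hXY : HasGaussianLaw (fun ω => (X ω, Y ω)) P) (hX : ∫ ω, X ω ∂P = 0)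
    (hY : ∫ ω, Y ω ∂P = 0) (hX2 : ∫ ω, X ω ^ 2 ∂P = 1) (hY2 : ∫ ω, Y ω ^ 2 ∂P = 1) {ρ : ℝ}
    (hρ : 0 < ρ) (hr : |∫ ω, X ω * Y ω ∂P| ≤ ρ) (a : ℝ) {b : ℝ} (hb : 0 ≤ b) :
    P.real ({ω | a ≤ X ω} ∩ {ω | b ≤ Y ω}) ≤
      P.real {ω | a ≤ X ω} * P.real {ω | b ≤ Y ω} + 4 * √ρ := by
  have := hXY.isProbabilityMeasure
  -- For ρ ≥ 1/9 the error term 4√ρ already exceeds 1.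
  rcases le_or_gt (1 / 9) ρ with h9 | h9
  · have h1 : P.real ({ω | a ≤ X ω} ∩ {ω | b ≤ Y ω}) ≤ 1 := measureReal_le_one
    have h2 : 1 / 3 ≤ √ρ := Real.le_sqrt_of_sq_le (by linarith)
    have h3 : 0 ≤ P.real {ω | a ≤ X ω} * P.real {ω | b ≤ Y ω} := by positivity
    linarith
  set r := ∫ ω, X ω * Y ω ∂P with hrdef
  have hXm := hXY.fst.memLp_two
  have hYm := hXY.snd.memLp_two
  have hr2 : r ^ 2 ≤ 1 / 4 := by
    rw [← sq_abs]
    have := abs_nonneg r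
    nlinarith
  set s := √(1 - r ^ 2) with hs
  have hs2 : s ^ 2 = 1 - r ^ 2 := Real.sq_sqrt (by linarith)
  have hs_half : 1 / 2 ≤ s := Real.le_sqrt_of_sq_le (by linarith)
  have hs_one : s ≤ 1 := by rw [hs]; exact Real.sqrt_le_one.2 (by linarith [sq_nonneg r])
  have hs0 : s ≠ 0 := by linarith
  -- The normalised residual of the regression of Y on X: standard normal and, being jointly
  -- Gaussian and uncorrelated with X, independent of it.
  set W : Ω → ℝ := fun ω => s⁻¹ * (Y ω - r * X ω) with hW
  have hXW : HasGaussianLaw (fun ω => (X ω, W ω)) P := by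
    let L : ℝ × ℝ →L[ℝ] ℝ × ℝ := (ContinuousLinearMap.fst ℝ ℝ ℝ).prod
      (s⁻¹ • (ContinuousLinearMap.snd ℝ ℝ ℝ - r • ContinuousLinearMap.fst ℝ ℝ ℝ))
    have := hXY.map_fun L
    simpa [L, hW] using this
  have iXY : Integrable (fun ω => X ω * Y ω) P := hXm.integrable_mul hYm
  have hX1 := hXY.fst.integrable
  have hY1 := hXY.snd.integrable
  have hWmean : ∫ ω, W ω ∂P = 0 := by
    rw [hW, integral_const_mul, integral_sub hY1 (hX1.const_mul r), integral_const_mul, hX, hY]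
    simp
  have hWsq : ∫ ω, W ω ^ 2 ∂P = 1 := by
    have : ∀ ω, W ω ^ 2 = (s ^ 2)⁻¹ * (Y ω ^ 2 - 2 * r * (X ω * Y ω) + r ^ 2 * X ω ^ 2) := by
      intro ω; simp only [hW]; rw [mul_pow, inv_pow]; ring
    simp_rw [this]
    rw [integral_const_mul, integral_add (by exact hYm.integrable_sq.sub (iXY.const_mul _))
      (hXm.integrable_sq.const_mul _), integral_sub hYm.integrable_sq (iXY.const_mul _),
      integral_const_mul, integral_const_mul, hX2, hY2, ← hrdef, hs2]
    have : 1 - r ^ 2 ≠ 0 := by linarith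
    field_simp
    ring
  have hcov : cov[X, W; P] = 0 := by
    rw [covariance_eq_sub hXm hXW.snd.memLp_two, hX, zero_mul, sub_zero]
    have : ∀ ω, (X * W) ω = s⁻¹ * (X ω * Y ω - r * X ω ^ 2) := by
      intro ω; simp only [hW, Pi.mul_apply]; ring
    simp_rw [this]
    rw [integral_const_mul, integral_sub iXY (hXm.integrable_sq.const_mul _), integral_const_mul,
      hX2, ← hrdef]
    simp
  have hind := hXW.indepFun_of_covariance_eq_zero hcov
  have hlawW : P.map W = gaussianReal 0 1 := by
    rw [HasGaussianLaw.map_eq_of_integral hXW.snd hWmean, hWsq, Real.toNNReal_one]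
  have hlawY : P.map Y = gaussianReal 0 1 := by
    rw [HasGaussianLaw.map_eq_of_integral hXY.snd hY, hY2, Real.toNNReal_one]
  have hevW : ∀ c, P.real {ω | c ≤ W ω} = (gaussianReal 0 1).real (Ici c) := by
    intro c
    rw [← hlawW, map_measureReal_apply_of_aemeasurable hXW.snd.aemeasurable measurableSet_Ici]
    rfl
  have hevY : P.real {ω | b ≤ Y ω} = (gaussianReal 0 1).real (Ici b) := by
    rw [← hlawY, map_measureReal_apply_of_aemeasurable hXY.snd.aemeasurable measurableSet_Ici]
    rfl
  have hρs : 0 < √ρ := Real.sqrt_pos.2 hρ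
  have hρ3 : √ρ ≤ 1 / 3 := Real.sqrt_le_iff.2 ⟨by norm_num, by linarith⟩
  have hρρ : √ρ * √ρ = ρ := Real.mul_self_sqrt hρ.le
  -- This truncation balances the two errors: |X| < T forces rX ≤ √ρ, while P(|X| ≥ T) ≤ 2√ρ.
  set T := 1 / √ρ with hT
  have hT0 : 0 < T := by positivity
  have hρT : ρ * T = √ρ := by rw [hT]; field_simp; nlinarith
  have hsub : {ω | a ≤ X ω} ∩ {ω | b ≤ Y ω} ⊆
      {ω | T ≤ |X ω|} ∪ ({ω | a ≤ X ω} ∩ {ω | b - 2 * √ρ ≤ W ω}) := by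
    rintro ω ⟨h1, h2⟩
    simp only [mem_ofPred_eq] at h1 h2
    by_cases hXT : T ≤ |X ω|
    · exact Or.inl hXT
    refine Or.inr ⟨h1, ?_⟩
    have hsW : s * W ω = Y ω - r * X ω := by simp only [hW]; field_simp
    have hrX : r * X ω ≤ √ρ := by
      rw [← hρT]
      refine (le_abs_self _).trans ?_
      rw [abs_mul]
      exact mul_le_mul hr (not_le.1 hXT).le (abs_nonneg _) hρ.le
    simp only [mem_ofPred_eq]
    -- Here sW ≥ b - √ρ with 1/2 ≤ s ≤ 1. For W ≥ 0 this gives W ≥ b - √ρ; for W < 0 it gives W ≥ 2b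
    -- - 2√ρ, and b ≥ 0 is needed.
    rcases le_or_gt 0 (W ω) with h | h <;> nlinarith
  refine (measureReal_mono hsub (by finiteness)).trans ((measureReal_union_le _ _).trans ?_)
  have hT1 : P.real {ω | T ≤ |X ω|} ≤ 2 * √ρ := by
    refine (HasGaussianLaw.measureReal_le_abs hXY.fst hX zero_le_one hX2.le hT0.le).trans ?_
    have h1 : -T ^ 2 / (2 * 1) = -(1 / (2 * ρ)) := by
      rw [hT, div_pow, Real.sq_sqrt hρ.le]; field_simp
    rw [h1, Real.exp_neg]
    have h2 : 1 / (2 * ρ) ≤ Real.exp (1 / (2 * ρ)) := by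
      linarith [Real.add_one_le_exp (1 / (2 * ρ))]
    have h3 := inv_anti₀ (by positivity) h2
    rw [show (1 / (2 * ρ))⁻¹ = 2 * ρ by rw [one_div, inv_inv]] at h3
    nlinarith
  have h2 : P.real ({ω | a ≤ X ω} ∩ {ω | b - 2 * √ρ ≤ W ω}) =
      P.real {ω | a ≤ X ω} * P.real {ω | b - 2 * √ρ ≤ W ω} := by
    have := hind.measure_inter_preimage_eq_mul (Ici a) (Ici (b - 2 * √ρ)) measurableSet_Ici
      measurableSet_Ici
    simp only [measureReal_def]
    rw [← ENNReal.toReal_mul]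
    exact congrArg _ this
  rw [h2, hevW, hevY]
  have h3 := gaussianReal_Ici_sub_le b (d := 2 * √ρ) (by positivity)
  have h4 : P.real {ω | a ≤ X ω} ≤ 1 := measureReal_le_one
  have h5 : 0 ≤ P.real {ω | a ≤ X ω} := measureReal_nonneg
  nlinarith

/-- The second moment method: a quantitative Borel–Cantelli estimate for nearly uncorrelated
events. -/
theorem measureReal_biInter_compl_le [IsProbabilityMeasure P] {ι : Type*} [DecidableEq ι]
    (s : Finset ι) (A : ι → Set Ω) (hA : ∀ i ∈ s, NullMeasurableSet (A i) P) (e : ι → ι → ℝ)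
    (he : ∀ i ∈ s, ∀ j ∈ s, i ≠ j →
      P.real (A i ∩ A j) ≤ P.real (A i) * P.real (A j) + e i j)
    (hm : 0 < ∑ i ∈ s, P.real (A i)) :
    P.real {ω | ∀ i ∈ s, ω ∉ A i} ≤
      (∑ i ∈ s, P.real (A i) + ∑ i ∈ s, ∑ j ∈ s.erase i, e i j) / (∑ i ∈ s, P.real (A i)) ^ 2 := by
  set m := ∑ i ∈ s, P.real (A i) with hmdef
  -- `N` counts the events that occur. When none does, (N - m)² = m², so Chebyshev bounds the
  -- probability by Var(N)/m².
  let N : Ω → ℝ := fun ω => ∑ i ∈ s, (A i).indicator (fun _ => (1 : ℝ)) ω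
  have hii : ∀ i ∈ s, Integrable ((A i).indicator (fun _ => (1 : ℝ))) P := fun i hi =>
    (integrable_const (1 : ℝ)).indicator₀ (hA i hi)
  have hN1 : ∫ ω, N ω ∂P = m := by
    simp only [N]
    rw [integral_finsetSum _ hii]
    refine Finset.sum_congr rfl fun i hi => ?_
    rw [integral_indicator₀ (hA i hi)]
    simp
  have hNN : ∀ ω, N ω ^ 2 = ∑ i ∈ s, ∑ j ∈ s, (A i ∩ A j).indicator (fun _ => (1 : ℝ)) ω := by
    intro ω
    simp only [N, pow_two, Finset.sum_mul_sum]
    refine Finset.sum_congr rfl fun i _ => Finset.sum_congr rfl fun j _ => ?_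
    have h := congrFun (inter_indicator_one (M₀ := ℝ) (s := A i) (t := A j)) ω
    simp only [Pi.mul_apply, Pi.one_def] at h
    rw [h]
  have hij : ∀ i ∈ s, ∀ j ∈ s, Integrable ((A i ∩ A j).indicator (fun _ => (1 : ℝ))) P :=
    fun i hi j hj => (integrable_const (1 : ℝ)).indicator₀ ((hA i hi).inter (hA j hj))
  have hN2i : Integrable (fun ω => N ω ^ 2) P := by
    simp_rw [hNN]
    exact integrable_finsetSum _ fun i hi => integrable_finsetSum _ fun j hj => hij i hi j hj
  have hNi : Integrable N P := integrable_finsetSum _ hii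
  have hN2 : ∫ ω, N ω ^ 2 ∂P = ∑ i ∈ s, ∑ j ∈ s, P.real (A i ∩ A j) := by
    simp_rw [hNN]
    rw [integral_finsetSum _ fun i hi => integrable_finsetSum _ fun j hj => hij i hi j hj]
    refine Finset.sum_congr rfl fun i hi => ?_
    rw [integral_finsetSum _ fun j hj => hij i hi j hj]
    refine Finset.sum_congr rfl fun j hj => ?_
    rw [integral_indicator₀ ((hA i hi).inter (hA j hj))]
    simp
  have hvar : ∫ ω, (N ω - m) ^ 2 ∂P ≤ m + ∑ i ∈ s, ∑ j ∈ s.erase i, e i j := by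
    have h1 : ∫ ω, (N ω - m) ^ 2 ∂P = ∫ ω, N ω ^ 2 ∂P - m ^ 2 := by
      have : ∀ ω, (N ω - m) ^ 2 = N ω ^ 2 - 2 * m * N ω + m ^ 2 := fun ω => by ring
      simp_rw [this]
      rw [integral_add (by exact hN2i.sub (hNi.const_mul _)) (integrable_const _),
        integral_sub hN2i (hNi.const_mul _), integral_const_mul, hN1]
      simp
      ring
    -- The diagonal contributes m; off the diagonal only the errors `e i j` survive the subtraction
    -- of m².
    have h2 : ∑ i ∈ s, ∑ j ∈ s, P.real (A i ∩ A j) ≤ ∑ i ∈ s, (P.real (A i) +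
        ∑ j ∈ s, P.real (A i) * P.real (A j) + ∑ j ∈ s.erase i, e i j) := by
      refine Finset.sum_le_sum fun i hi => ?_
      rw [← Finset.add_sum_erase s _ hi, inter_self, add_assoc]
      gcongr
      rw [← Finset.add_sum_erase s (fun j => P.real (A i) * P.real (A j)) hi, add_assoc,
        ← Finset.sum_add_distrib]
      have h3 : ∑ j ∈ s.erase i, P.real (A i ∩ A j) ≤
          ∑ j ∈ s.erase i, (P.real (A i) * P.real (A j) + e i j) :=
        Finset.sum_le_sum fun j hj => he i hi j (Finset.mem_of_mem_erase hj)
          (Finset.ne_of_mem_erase hj).symm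
      have h4 : 0 ≤ P.real (A i) * P.real (A i) := by positivity
      linarith
    rw [h1, hN2]
    rw [Finset.sum_add_distrib, Finset.sum_add_distrib, ← hmdef, ← Finset.sum_mul_sum, ← hmdef]
      at h2
    linarith
  rw [le_div_iff₀ (by positivity), mul_comm]
  refine le_trans ?_ hvar
  have hNmi : Integrable (fun ω => (N ω - m) ^ 2) P := by
    have : ∀ ω, (N ω - m) ^ 2 = N ω ^ 2 - 2 * m * N ω + m ^ 2 := fun ω => by ring
    simp_rw [this]
    exact (hN2i.sub (hNi.const_mul _)).add (integrable_const _)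
  have hmk := mul_meas_ge_le_integral_of_nonneg (ae_of_all P fun ω => sq_nonneg (N ω - m)) hNmi
    (m ^ 2)
  refine le_trans ?_ hmk
  refine mul_le_mul_of_nonneg_left (measureReal_mono (fun ω hω => ?_) (by finiteness))
    (sq_nonneg m)
  have : N ω = 0 := Finset.sum_eq_zero fun i hi => indicator_of_notMem (hω i hi) _
  simp [this]

end Tails

/-! ### The supremum over a unit interval -/

section Chaining

/-- Chaining along `256`-adic points: a continuous function is bounded on a unit interval if it is
bounded on a grid and its increments along the finer grids are small. -/
theorem abs_lt_of_chaining {f : ℝ → ℝ} (hf : Continuous f) {k l ε : ℝ} (hl : 0 ≤ ε * l) (N : ℕ)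
    (h0 : ∀ i : ℕ, i ≤ 256 ^ N → |f (k + i / 256 ^ N)| < (1 - ε) * l)
    (h1 : ∀ j i : ℕ, i ≤ 256 ^ (N + j + 1) →
      |f (k + i / 256 ^ (N + j + 1)) - f (k + (i / 256 : ℕ) / 256 ^ (N + j))| ≤
        ε * l * (1 / 2) ^ (j + 1))
    {x : ℝ} (hx : x ∈ Icc k (k + 1)) : |f x| < l := by
  -- The left 256-adic neighbours of x. Dividing an index by 256 gives its parent, so the hypothesis
  -- on increments applies along this chain, with total at most ε l.
  set i : ℕ → ℕ := fun n => ⌊(256 : ℝ) ^ n * (x - k)⌋₊ with hi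
  have hxk : 0 ≤ x - k := sub_nonneg.2 hx.1
  have hxk1 : x - k ≤ 1 := by linarith [hx.2]
  have hile : ∀ n, i n ≤ 256 ^ n := by
    intro n
    refine Nat.floor_le_of_le ?_
    push_cast
    exact mul_le_of_le_one_right (by positivity) hxk1
  have hidiv : ∀ n, i (n + 1) / 256 = i n := by
    intro n
    simp only [hi]
    rw [← Nat.floor_div_natCast]
    congr 1
    push_cast
    ring
  have htend : Tendsto (fun n => k + (i n : ℝ) / 256 ^ n) atTop (𝓝 x) := by
    have hdiff : ∀ n, |k + (i n : ℝ) / 256 ^ n - x| ≤ (1 / 256) ^ n := by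
      intro n
      have hp : (0 : ℝ) < 256 ^ n := by positivity
      have h2 : (i n : ℝ) ≤ 256 ^ n * (x - k) := Nat.floor_le (by positivity)
      have h3 : (256 : ℝ) ^ n * (x - k) < i n + 1 := Nat.lt_floor_add_one _
      have e : k + (i n : ℝ) / 256 ^ n - x = (i n - 256 ^ n * (x - k)) * (1 / 256) ^ n := by
        rw [one_div, inv_pow]; field_simp; ring
      rw [e, abs_mul, abs_of_pos (show (0 : ℝ) < (1 / 256) ^ n by positivity)]
      refine mul_le_of_le_one_left (by positivity) (abs_le.2 ⟨by linarith, by linarith⟩)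
    rw [tendsto_iff_dist_tendsto_zero]
    refine squeeze_zero (fun n => dist_nonneg) (fun n => (Real.dist_eq _ _).trans_le (hdiff n)) ?_
    exact tendsto_pow_atTop_nhds_zero_of_lt_one (by norm_num) (by norm_num)
  have hbound : ∀ j, |f (k + (i (N + j) : ℝ) / 256 ^ (N + j))| ≤
      |f (k + (i N : ℝ) / 256 ^ N)| + ε * l * (1 - (1 / 2) ^ j) := by
    intro j
    induction j with
    | zero => simp
    | succ j ih =>
      have h := h1 j (i (N + j + 1)) (hile _)
      rw [hidiv] at h
      have h2 := abs_sub_abs_le_abs_sub (f (k + (i (N + j + 1) : ℝ) / 256 ^ (N + j + 1)))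
        (f (k + (i (N + j) : ℝ) / 256 ^ (N + j)))
      have h3 : ε * l * (1 - (1 / 2) ^ (j + 1)) =
          ε * l * (1 - (1 / 2) ^ j) + ε * l * (1 / 2) ^ (j + 1) := by ring
      rw [h3, ← add_assoc N j 1]
      linarith
  have hlim : Tendsto (fun j => |f (k + (i (N + j) : ℝ) / 256 ^ (N + j))|) atTop (𝓝 |f x|) := by
    have := ((hf.abs.tendsto x).comp htend).comp (tendsto_add_atTop_nat N)
    refine this.congr fun j => ?_
    simp [add_comm]
  have hle : |f x| ≤ |f (k + (i N : ℝ) / 256 ^ N)| + ε * l := by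
    refine le_of_tendsto' hlim fun j => (hbound j).trans ?_
    have : (0 : ℝ) ≤ (1 / 2) ^ j := by positivity
    nlinarith
  have := h0 (i N) (hile N)
  linarith

variable {Ω : Type*} [MeasurableSpace Ω] {P : Measure Ω} {X : ℝ → Ω → ℝ} {c K : ℝ}

theorem IsDecorrelatingField.measure_le_abs (hX : IsDecorrelatingField P X c K) (x : ℝ) {a : ℝ}
    (ha : 0 ≤ a) : P {ω | a ≤ |X x ω|} ≤ ENNReal.ofReal (2 * Real.exp (-a ^ 2 / 2)) := by
  have := (hX.gaussian x x).isProbabilityMeasure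
  rw [← ofReal_measureReal]
  refine ENNReal.ofReal_le_ofReal ?_
  have := HasGaussianLaw.measureReal_le_abs (hX.gaussian x x).fst (hX.mean x) zero_le_one
    (hX.sq x).le ha
  simpa using this

theorem IsDecorrelatingField.measure_le_abs_sub (hX : IsDecorrelatingField P X c K) {x y v : ℝ}
    (hv0 : 0 ≤ v) (hv : K * √|x - y| ≤ v) {a : ℝ} (ha : 0 ≤ a) :
    P {ω | a ≤ |X x ω - X y ω|} ≤ ENNReal.ofReal (2 * Real.exp (-a ^ 2 / (2 * v))) := by
  have := (hX.gaussian x x).isProbabilityMeasure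
  rw [← ofReal_measureReal]
  refine ENNReal.ofReal_le_ofReal ?_
  refine HasGaussianLaw.measureReal_le_abs (hX.gaussian x y).fun_sub ?_ hv0
    ((hX.incr_le x y).trans hv) ha
  rw [integral_sub (hX.gaussian x y).fst.integrable (hX.gaussian x y).snd.integrable, hX.mean,
    hX.mean, sub_self]

/-- Since (l² - 1)(4^j - 1) ≥ 0, one has l²4^j ≥ l² + 4^j - 1. Then e^{-y} ≤ 5!/y⁵ at y = 4^j gives
a decay 1024^{-j} that beats the growth 256^j of the chaining grids. -/
theorem exp_neg_mul_four_pow_le {l : ℝ} (hl : 1 ≤ l) (j : ℕ) :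
    Real.exp (-(l ^ 2 * 4 ^ j)) ≤ Real.exp (-l ^ 2) * (Real.exp 1 * 120 / 1024 ^ j) := by
  have h1 : Real.exp (-(l ^ 2 * 4 ^ j)) ≤ Real.exp (-l ^ 2 + (1 + -(4 : ℝ) ^ j)) := by
    refine Real.exp_le_exp.2 ?_
    have h4 : (1 : ℝ) ≤ 4 ^ j := one_le_pow₀ (by norm_num)
    have h5 : 1 ≤ l ^ 2 := one_le_pow₀ hl
    nlinarith [mul_nonneg (sub_nonneg.2 h5) (sub_nonneg.2 h4)]
  refine h1.trans ?_
  rw [Real.exp_add, Real.exp_add, mul_div_assoc]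
  gcongr
  rw [Real.exp_neg]
  have h2 := Real.pow_div_factorial_le_exp ((4 : ℝ) ^ j) (by positivity) 5
  have h3 := inv_anti₀ (by positivity) h2
  rw [inv_div, ← pow_mul, mul_comm j 5, pow_mul] at h3
  norm_num [Nat.factorial] at h3 ⊢
  exact h3

/-- The Gaussian tail of the supremum over a unit interval, with nearly optimal exponent. -/
theorem IsDecorrelatingField.exists_measure_sup_le [IsProbabilityMeasure P]
    (hX : IsDecorrelatingField P X c K) {q : ℝ} (hq0 : 0 ≤ q) (hq : q < 1 / 2) :
    ∃ C : ℝ, 0 < C ∧ ∀ k l : ℝ, 0 ≤ l →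
      P {ω | ∃ x ∈ Icc k (k + 1), l ≤ |X x ω|} ≤ ENNReal.ofReal (C * Real.exp (-(q * l ^ 2))) := by
  -- The level is split: (1-ε)l is spent on the coarse grid, where (1-ε)²/2 ≥ q keeps the exponent,
  -- and εl on the increments.
  obtain ⟨ε, hε0, hε1, hεq⟩ : ∃ ε : ℝ, 0 < ε ∧ ε < 1 ∧ 2 * q ≤ (1 - ε) ^ 2 :=
    ⟨(1 - 2 * q) / 2, by linarith, by linarith, by nlinarith [sq_nonneg (1 - 2 * q)]⟩
  -- The starting grid is fine enough that the exponent of the increments at level j is at least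
  -- l²4^j.
  obtain ⟨N, hN⟩ : ∃ N : ℕ, 8 * max K 1 / ε ^ 2 ≤ 16 ^ N :=
    pow_unbounded_of_one_lt _ (by norm_num : (1 : ℝ) < 16) |>.imp fun _ h => h.le
  have hK1 : 0 < max K 1 := by positivity
  set D : ℝ := (256 ^ (N + 1) * 2) * 2 * (Real.exp 1 * 120) with hD
  have hD0 : 0 < D := by positivity
  -- The three terms pay for the coarse grid, for the increments, and for l < 1, where `Real.exp 1`
  -- makes the bound at least 1.
  refine ⟨256 ^ N * 2 * 2 + D * 2 + Real.exp 1, by positivity, fun k l hl => ?_⟩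
  rcases lt_or_ge l 1 with hl1 | hl1
  · refine prob_le_one.trans ?_
    rw [← ENNReal.ofReal_one]
    refine ENNReal.ofReal_le_ofReal ?_
    have h1 : Real.exp (-1) ≤ Real.exp (-(q * l ^ 2)) := Real.exp_le_exp.2 (by nlinarith)
    have h2 : Real.exp 1 * Real.exp (-1) = 1 := by rw [← Real.exp_add]; simp
    have h3 : Real.exp 1 * Real.exp (-1) ≤ Real.exp 1 * Real.exp (-(q * l ^ 2)) := by gcongr
    have h4 : 0 ≤ (256 ^ N * 2 * 2 + D * 2) * Real.exp (-(q * l ^ 2)) := by positivity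
    linarith
  have hεl : 0 ≤ ε * l := by positivity
  let A : Set Ω := ⋃ i ∈ Finset.range (256 ^ N + 1),
    {ω | (1 - ε) * l ≤ |X (k + (i : ℝ) / 256 ^ N) ω|}
  let B : ℕ → Set Ω := fun j => ⋃ i ∈ Finset.range (256 ^ (N + j + 1) + 1),
    {ω | ε * l * (1 / 2) ^ (j + 1) ≤ |X (k + (i : ℝ) / 256 ^ (N + j + 1)) ω -
      X (k + ((i / 256 : ℕ) : ℝ) / 256 ^ (N + j)) ω|}
  have hsub : {ω | ∃ x ∈ Icc k (k + 1), l ≤ |X x ω|} ≤ᵐ[P] (A ∪ ⋃ j, B j : Set Ω) := by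
    filter_upwards [hX.continuous] with ω hω
    rintro ⟨x, hx, hlx⟩
    by_contra hcon
    change ω ∉ A ∪ ⋃ j, B j at hcon
    simp only [A, B, mem_union, mem_iUnion, mem_ofPred_eq, Finset.mem_range, not_or, not_exists,
      not_le, Nat.lt_succ_iff] at hcon
    exact absurd hlx (not_le.2 (abs_lt_of_chaining hω hεl N hcon.1
      (fun j i hi => (hcon.2 j i hi).le) hx))
  have hA : P A ≤ ENNReal.ofReal (256 ^ N * 2 * 2 * Real.exp (-(q * l ^ 2))) := by
    refine (measure_biUnion_finset_le _ _).trans ?_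
    refine (Finset.sum_le_sum fun i _ => hX.measure_le_abs _
      (mul_nonneg (by linarith : (0 : ℝ) ≤ 1 - ε) hl)).trans ?_
    rw [Finset.sum_const, Finset.card_range, ← ENNReal.ofReal_nsmul, nsmul_eq_mul]
    refine ENNReal.ofReal_le_ofReal ?_
    have h1 : ((256 ^ N + 1 : ℕ) : ℝ) ≤ 256 ^ N * 2 := by
      have : (1 : ℝ) ≤ 256 ^ N := one_le_pow₀ (by norm_num)
      push_cast; linarith
    have h2 : Real.exp (-((1 - ε) * l) ^ 2 / 2) ≤ Real.exp (-(q * l ^ 2)) := by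
      refine Real.exp_le_exp.2 ?_
      nlinarith [sq_nonneg l]
    calc ((256 ^ N + 1 : ℕ) : ℝ) * (2 * Real.exp (-((1 - ε) * l) ^ 2 / 2))
        ≤ 256 ^ N * 2 * (2 * Real.exp (-(q * l ^ 2))) := by gcongr
      _ = _ := by ring
  have hB : ∀ j, P (B j) ≤ ENNReal.ofReal (D * Real.exp (-(q * l ^ 2)) * (1 / 2) ^ j) := by
    intro j
    refine (measure_biUnion_finset_le _ _).trans ?_
    have hstep : ∀ i : ℕ, P {ω | ε * l * (1 / 2) ^ (j + 1) ≤
        |X (k + (i : ℝ) / 256 ^ (N + j + 1)) ω -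
          X (k + ((i / 256 : ℕ) : ℝ) / 256 ^ (N + j)) ω|} ≤
        ENNReal.ofReal (2 * (Real.exp (-(q * l ^ 2)) * (Real.exp 1 * 120 / 1024 ^ j))) := by
      intro i
      have hdist : |k + (i : ℝ) / 256 ^ (N + j + 1) - (k + ((i / 256 : ℕ) : ℝ) / 256 ^ (N + j))| ≤
          (1 / 256) ^ (N + j) := by
        have h256 : (0 : ℝ) < 256 ^ (N + j) := by positivity
        have hmod := Nat.div_add_mod i 256
        have hlt := Nat.mod_lt i (show 0 < 256 by norm_num)
        have e : k + (i : ℝ) / 256 ^ (N + j + 1) - (k + ((i / 256 : ℕ) : ℝ) / 256 ^ (N + j)) =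
            ((i % 256 : ℕ) : ℝ) / 256 * (1 / 256) ^ (N + j) := by
          have : (i : ℝ) = 256 * ((i / 256 : ℕ) : ℝ) + ((i % 256 : ℕ) : ℝ) := by
            exact_mod_cast hmod.symm
          rw [one_div, inv_pow, pow_succ]
          conv_lhs => rw [this]
          field_simp
          ring
        rw [e, abs_of_nonneg (by positivity)]
        refine mul_le_of_le_one_left (by positivity) ?_
        rw [div_le_one (by norm_num)]
        exact_mod_cast hlt.le
      have hsqrt : √|k + (i : ℝ) / 256 ^ (N + j + 1) - (k + ((i / 256 : ℕ) : ℝ) / 256 ^ (N + j))| ≤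
          (1 / 16) ^ (N + j) := by
        refine Real.sqrt_le_iff.2 ⟨by positivity, hdist.trans (le_of_eq ?_)⟩
        rw [← pow_mul, mul_comm, pow_mul]
        norm_num
      refine (hX.measure_le_abs_sub (v := max K 1 * (1 / 16) ^ (N + j)) (by positivity) ?_
        (by positivity)).trans (ENNReal.ofReal_le_ofReal ?_)
      · exact mul_le_mul (le_max_left _ _) hsqrt (Real.sqrt_nonneg _) hK1.le
      · have h1 : -(ε * l * (1 / 2) ^ (j + 1)) ^ 2 / (2 * (max K 1 * (1 / 16) ^ (N + j))) ≤
            -(l ^ 2 * 4 ^ j) := by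
          rw [neg_div, neg_le_neg_iff, le_div_iff₀ (by positivity)]
          rw [div_le_iff₀ (by positivity)] at hN
          have e1 : ((1 / 2 : ℝ) ^ (j + 1)) ^ 2 = (1 / 4) * (1 / 4) ^ j := by
            rw [← pow_mul, mul_comm, pow_mul, pow_succ]; norm_num; ring
          have e2 : (4 : ℝ) ^ j * (1 / 16) ^ j = (1 / 4) ^ j := by
            rw [← mul_pow]; norm_num
          have e3 : (16 : ℝ) ^ N * (1 / 16) ^ N = 1 := by rw [← mul_pow]; norm_num
          have h := mul_le_mul_of_nonneg_right hN
            (show 0 ≤ l ^ 2 * (1 / 16 : ℝ) ^ N * (1 / 4) ^ j / 4 by positivity)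
          calc l ^ 2 * 4 ^ j * (2 * (max K 1 * (1 / 16) ^ (N + j)))
              = 8 * max K 1 * (l ^ 2 * (1 / 16) ^ N * (4 ^ j * (1 / 16) ^ j) / 4) := by
                rw [pow_add]; ring
            _ ≤ (16 ^ N * ε ^ 2) * (l ^ 2 * (1 / 16 : ℝ) ^ N * (1 / 4) ^ j / 4) := by
                rw [e2]; exact h
            _ = (16 ^ N * (1 / 16 : ℝ) ^ N) * (ε ^ 2 * l ^ 2 * ((1 / 4) * (1 / 4) ^ j)) := by ring
            _ = (ε * l * (1 / 2) ^ (j + 1)) ^ 2 := by rw [e3, mul_pow, mul_pow, e1]; ring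
        have h2 : Real.exp (-l ^ 2) ≤ Real.exp (-(q * l ^ 2)) :=
          Real.exp_le_exp.2 (by nlinarith [sq_nonneg l])
        have h3 := (Real.exp_le_exp.2 h1).trans (exp_neg_mul_four_pow_le hl1 j)
        refine mul_le_mul_of_nonneg_left (h3.trans ?_) zero_le_two
        gcongr
    refine (Finset.sum_le_sum fun i _ => hstep i).trans ?_
    rw [Finset.sum_const, Finset.card_range, ← ENNReal.ofReal_nsmul, nsmul_eq_mul]
    refine ENNReal.ofReal_le_ofReal ?_
    have h1 : ((256 ^ (N + j + 1) + 1 : ℕ) : ℝ) ≤ 256 ^ (N + 1) * 2 * 256 ^ j := by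
      have h1 : (1 : ℝ) ≤ 256 ^ (N + j + 1) := one_le_pow₀ (by norm_num)
      have h2 : (256 : ℝ) ^ (N + j + 1) = 256 ^ (N + 1) * 256 ^ j := by ring
      push_cast; linarith
    have h2 : (256 : ℝ) ^ j * (1 / 1024 ^ j) ≤ (1 / 2) ^ j := by
      rw [← one_div_pow, ← mul_pow]
      exact pow_le_pow_left₀ (by norm_num) (by norm_num) j
    calc ((256 ^ (N + j + 1) + 1 : ℕ) : ℝ) *
          (2 * (Real.exp (-(q * l ^ 2)) * (Real.exp 1 * 120 / 1024 ^ j)))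
        ≤ 256 ^ (N + 1) * 2 * 256 ^ j *
          (2 * (Real.exp (-(q * l ^ 2)) * (Real.exp 1 * 120 / 1024 ^ j))) := by gcongr
      _ = D * Real.exp (-(q * l ^ 2)) * (256 ^ j * (1 / 1024 ^ j)) := by rw [hD]; ring
      _ ≤ _ := by gcongr
  have hBsum : P (⋃ j, B j) ≤ ENNReal.ofReal (D * 2 * Real.exp (-(q * l ^ 2))) := by
    refine (measure_iUnion_le B).trans ((ENNReal.tsum_le_tsum hB).trans ?_)
    rw [← ENNReal.ofReal_tsum_of_nonneg (fun j => by positivity)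
      (summable_geometric_two.mul_left _), tsum_mul_left, tsum_geometric_two]
    exact le_of_eq (by ring_nf)
  refine (measure_mono_ae hsub).trans ((measure_union_le _ _).trans ((add_le_add hA hBsum).trans ?_))
  rw [← ENNReal.ofReal_add (by positivity) (by positivity)]
  refine ENNReal.ofReal_le_ofReal ?_
  have : 0 ≤ Real.exp 1 * Real.exp (-(q * l ^ 2)) := by positivity
  linarith

end Chaining

/-! ### Bounds for the macroscopic dimension -/

section MacroDim

theorem shellContent_mono (n : ℕ) (ρ : ℝ) {E F : Set ℝ} (h : E ⊆ F) :
    shellContent n ρ E ≤ shellContent n ρ F := by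
  unfold shellContent
  gcongr
  exact le_iInf fun hr => iInf_le_of_le ((inter_subset_inter_left _ h).trans hr) le_rfl

theorem macroDim_mono {E F : Set ℝ} (h : E ⊆ F) : macroDim E ≤ macroDim F := by
  unfold macroDim
  gcongr with ρ hρ
  refine le_iInf fun hF => iInf_le_of_le ?_ le_rfl
  exact (ENNReal.tsum_le_tsum fun n => shellContent_mono _ _ h).trans_lt hF

theorem macroDim_le {E : Set ℝ} {ρ : ℝ} (hρ : 0 < ρ)
    (h : ∑' n : ℕ, shellContent (n + 1) ρ E < ∞) : macroDim E ≤ ENNReal.ofReal ρ :=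
  (iInf_le _ ρ).trans ((iInf_le _ hρ).trans (iInf_le _ h))

/-- The content is at most that of a cover by unit intervals. -/
theorem shellContent_le_card {n : ℕ} {ρ : ℝ} {E : Set ℝ} (T : Finset ℕ)
    (hT : E ∩ expShell n ⊆ ⋃ k ∈ T, Ico (k : ℝ) (k + 1)) :
    shellContent n ρ E ≤ ∑ _k ∈ T, ENNReal.ofReal ((1 / Real.exp n) ^ ρ) := by
  let e := T.equivFin
  unfold shellContent
  refine (iInf_le _ T.card).trans ((iInf_le _ fun i => ((e.symm i : ℕ) : ℝ)).trans
    ((iInf_le _ fun _ => 1).trans ((iInf_le _ fun _ => le_rfl).trans ((iInf_le _ ?_).trans ?_))))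
  · intro x hx
    obtain ⟨k, hk, hxk⟩ := mem_iUnion₂.1 (hT hx)
    exact mem_iUnion.2 ⟨e ⟨k, hk⟩, by simpa using hxk⟩
  · simp

theorem mem_expShell_succ_of_nonneg {n : ℕ} {x : ℝ} (hx : 0 ≤ x) :
    x ∈ expShell (n + 1) ↔ Real.exp n ≤ x ∧ x < Real.exp (n + 1) := by
  have h1 := Real.exp_pos (n : ℝ)
  have h2 := Real.exp_pos ((n : ℝ) + 1)
  simp only [expShell, Set.mem_sdiff, mem_Ico, not_and, not_lt]
  refine ⟨fun h => ⟨h.2 (by linarith), h.1.2⟩, fun h => ⟨⟨by linarith, h.2⟩, fun _ => h.1⟩⟩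

theorem card_le_of_forall_mem_Ioo {a b : ℝ} (hab : a ≤ b) (T : Finset ℕ)
    (hT : ∀ j ∈ T, a < j ∧ (j : ℝ) < b) : (T.card : ℝ) ≤ b - a + 1 := by
  have hsub : T.image (Nat.cast : ℕ → ℤ) ⊆ Finset.Ioo ⌊a⌋ ⌈b⌉ := by
    intro z hz
    obtain ⟨j, hj, rfl⟩ := Finset.mem_image.1 hz
    refine Finset.mem_Ioo.2 ⟨Int.floor_lt.2 ?_, Int.lt_ceil.2 ?_⟩
    · exact_mod_cast (hT j hj).1
    · exact_mod_cast (hT j hj).2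
  have h := Finset.card_le_card hsub
  rw [Finset.card_image_of_injective _ Nat.cast_injective, Int.card_Ioo] at h
  have h1 : ⌊a⌋ ≤ ⌈b⌉ := (Int.floor_le_floor hab).trans (Int.floor_le_ceil b)
  have h2 : (T.card : ℤ) ≤ max (⌈b⌉ - ⌊a⌋ - 1) 0 := by
    rw [← Int.toNat_of_nonneg (le_max_right (⌈b⌉ - ⌊a⌋ - 1) 0)]
    refine Int.ofNat_le.2 (h.trans ?_)
    exact Int.toNat_le_toNat (le_max_left _ _)
  have h3 : (T.card : ℝ) ≤ max ((⌈b⌉ : ℝ) - ⌊a⌋ - 1) 0 := by exact_mod_cast h2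
  refine h3.trans (max_le ?_ (by linarith))
  have := Int.ceil_lt_add_one b
  have := Int.lt_floor_add_one a
  linarith

/-- If a set meets at least half of the blocks of length `e^{θ n}` in a shell, then its content of
any order `ρ ≤ 1 - θ` in that shell is bounded below. -/
theorem le_shellContent_of_blocks {E : Set ℝ} {θ ρ : ℝ} {n : ℕ} (hθ : θ < 1) (hρ : 0 < ρ)
    (hρθ : ρ ≤ 1 - θ) (hθ0 : 0 ≤ θ) (T : Finset ℕ)
    (hTJ : T ⊆ Finset.range ⌊Real.exp ((1 - θ) * n)⌋₊)
    (hT : ⌊Real.exp ((1 - θ) * n)⌋₊ ≤ 2 * T.card)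
    (hE : ∀ j ∈ T, ∃ x ∈ E, Real.exp n + j * Real.exp (θ * n) ≤ x ∧
      x < Real.exp n + (j + 1) * Real.exp (θ * n)) :
    ENNReal.ofReal (1 / (12 * Real.exp 1)) ≤ shellContent (n + 1) ρ E := by
  classical
  choose! y hyE hy1 hy2 using hE
  set L := Real.exp (θ * n) with hL
  set R := Real.exp ((1 - θ) * n) with hR
  have hL0 : 0 < L := Real.exp_pos _
  have hR0 : 0 < R := Real.exp_pos _
  have hR1 : 1 ≤ R := Real.one_le_exp (mul_nonneg (by linarith) (Nat.cast_nonneg n))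
  have hRL : R * L = Real.exp n := by rw [hL, hR, ← Real.exp_add]; congr 1; ring
  have he1 : 2 ≤ Real.exp 1 := by linarith [Real.add_one_le_exp (1 : ℝ)]
  have hshell : ∀ j ∈ T, y j ∈ E ∩ expShell (n + 1) := by
    intro j hj
    have hn : 0 < Real.exp n := Real.exp_pos _
    have hjJ : ((j : ℝ) + 1) ≤ R := by
      have h1 : j + 1 ≤ ⌊R⌋₊ := Finset.mem_range.1 (hTJ hj)
      have h2 := Nat.floor_le hR0.le
      have h3 : ((j + 1 : ℕ) : ℝ) ≤ (⌊R⌋₊ : ℝ) := Nat.cast_le.2 h1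
      push_cast at h3
      linarith
    have h1 := hy1 j hj
    have h2 := hy2 j hj
    have h3 : 0 ≤ (j : ℝ) * L := by positivity
    refine ⟨hyE j hj, (mem_expShell_succ_of_nonneg (by linarith)).2 ⟨by linarith, ?_⟩⟩
    have h4 : ((j : ℝ) + 1) * L ≤ R * L := by gcongr
    have h5 : Real.exp ((n : ℝ) + 1) = Real.exp n * Real.exp 1 := Real.exp_add _ _
    rw [hRL] at h4
    nlinarith
  unfold shellContent
  refine le_iInf fun m => le_iInf fun x => le_iInf fun r => le_iInf fun hr => le_iInf fun hcov => ?_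
  rw [← ENNReal.ofReal_sum_of_nonneg fun i _ =>
    Real.rpow_nonneg (div_nonneg (by linarith [hr i]) (Real.exp_pos _).le) _]
  refine ENNReal.ofReal_le_ofReal ?_
  have hu0 : ∀ i, 0 < r i / Real.exp ((n + 1 : ℕ) : ℝ) := fun i =>
    div_pos (by linarith [hr i]) (Real.exp_pos _)
  -- An interval longer than the shell scale contributes at least 1 on its own.
  by_cases hbig : ∃ i, 1 < r i / Real.exp ((n + 1 : ℕ) : ℝ)
  · obtain ⟨i, hi⟩ := hbig
    have h1 : 1 / (12 * Real.exp 1) ≤ 1 := by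
      rw [div_le_one (by positivity)]; linarith
    refine h1.trans ((Real.one_le_rpow hi.le hρ.le).trans ?_)
    exact Finset.single_le_sum (f := fun i => (r i / Real.exp ((n + 1 : ℕ) : ℝ)) ^ ρ)
      (fun i _ => Real.rpow_nonneg (hu0 i).le _) (Finset.mem_univ i)
  simp only [not_exists, not_lt] at hbig
  have hmem : ∀ j ∈ T, ∃ i, y j ∈ Ico (x i) (x i + r i) := fun j hj =>
    mem_iUnion.1 (hcov (hshell j hj))
  have : Nonempty (Fin m) := by
    have h1 : 1 ≤ ⌊R⌋₊ := (Nat.one_le_floor_iff R).2 hR1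
    obtain ⟨j, hj⟩ := Finset.card_pos.1 (show 0 < T.card by omega)
    exact ⟨(hmem j hj).choose⟩
  choose! φ hφ using hmem
  -- An interval of side r accounts for at most r/L + 2 blocks. With u = r/e^{n+1} one has r/L = eRu
  -- ≤ eRu^ρ, as u ≤ 1 and ρ ≤ 1, and also 1 ≤ eRu^ρ, as r ≥ 1 and ρ ≤ 1 - θ; hence the factor 3.
  have hfib : ∀ i, ((T.filter fun j => φ j = i).card : ℝ) ≤
      3 * Real.exp 1 * R * (r i / Real.exp ((n + 1 : ℕ) : ℝ)) ^ ρ := by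
    intro i
    have hri := hr i
    have hcard : ((T.filter fun j => φ j = i).card : ℝ) ≤ r i / L + 2 := by
      have h := card_le_of_forall_mem_Ioo (a := (x i - Real.exp n) / L - 1)
        (b := (x i + r i - Real.exp n) / L) ?_ (T.filter fun j => φ j = i) ?_
      · refine h.trans (le_of_eq ?_)
        field_simp
        ring
      · have : (x i - Real.exp n) / L ≤ (x i + r i - Real.exp n) / L := by gcongr; linarith
        linarith
      · intro j hj
        obtain ⟨hjT, rfl⟩ := Finset.mem_filter.1 hj
        have h1 := hy1 j hjT
        have h2 := hy2 j hjT
        have h3 := hφ j hjT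
        constructor
        · rw [sub_lt_iff_lt_add, div_lt_iff₀ hL0]
          linarith [h3.1]
        · rw [lt_div_iff₀ hL0]
          linarith [h3.2]
    set u := r i / Real.exp ((n + 1 : ℕ) : ℝ) with hu
    have hu1 : u ≤ 1 := hbig i
    have hup := hu0 i
    have hexp : Real.exp ((n + 1 : ℕ) : ℝ) = R * L * Real.exp 1 := by
      rw [hRL]; push_cast; exact Real.exp_add _ _
    have hrL : r i / L = Real.exp 1 * R * u := by
      rw [hu, hexp]; field_simp
    have h1 : u ≤ u ^ ρ := by
      conv_lhs => rw [← Real.rpow_one u]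
      exact Real.rpow_le_rpow_of_exponent_ge hup hu1 (by linarith)
    have h2 : 1 ≤ Real.exp 1 * R * u ^ ρ := by
      have h3 : Real.exp (-((n + 1 : ℕ) : ℝ)) ≤ u := by
        rw [hu, Real.exp_neg, le_div_iff₀ (Real.exp_pos _),
          inv_mul_cancel₀ (Real.exp_pos _).ne']
        exact hri
      have h4 : Real.exp (-((n + 1 : ℕ) : ℝ)) ^ ρ ≤ u ^ ρ :=
        Real.rpow_le_rpow (Real.exp_pos _).le h3 hρ.le
      rw [← Real.exp_mul] at h4
      have h5 : 1 ≤ Real.exp 1 * R * Real.exp (-((n + 1 : ℕ) : ℝ) * ρ) := by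
        rw [hR, ← Real.exp_add, ← Real.exp_add]
        refine Real.one_le_exp ?_
        push_cast
        have hn0 : (0 : ℝ) ≤ n := Nat.cast_nonneg n
        nlinarith
      refine h5.trans ?_
      gcongr
    have h3 : Real.exp 1 * R * u ≤ Real.exp 1 * R * u ^ ρ := by gcongr
    rw [hrL] at hcard
    linarith
  have hsum : (T.card : ℝ) ≤ 3 * Real.exp 1 * R *
      ∑ i, (r i / Real.exp ((n + 1 : ℕ) : ℝ)) ^ ρ := by
    rw [Finset.card_eq_sum_card_fiberwise (f := φ) (t := Finset.univ) (by simp), Finset.mul_sum]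
    push_cast
    exact Finset.sum_le_sum fun i _ => by simpa using hfib i
  have hJ : R / 2 ≤ (⌊R⌋₊ : ℝ) := by
    have h1 := Nat.lt_floor_add_one R
    have h2 : (1 : ℝ) ≤ (⌊R⌋₊ : ℝ) := by exact_mod_cast (Nat.one_le_floor_iff R).2 hR1
    linarith
  have hT' : (⌊R⌋₊ : ℝ) ≤ 2 * T.card := by exact_mod_cast hT
  -- The 12 is 3 · 2 · 2: the factor 3 per interval, half of the blocks, and ⌊R⌋ ≥ R/2.
  rw [div_le_iff₀ (by positivity)]
  have h6 : R * 1 ≤ R * ((∑ i, (r i / Real.exp ((n + 1 : ℕ) : ℝ)) ^ ρ) * (12 * Real.exp 1)) := by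
    linarith
  exact le_of_mul_le_mul_left h6 hR0

/-- A set that meets at least half of the blocks of length `e^{θ n}` in infinitely many shells has
macroscopic dimension at least `1 - θ`. -/
theorem le_macroDim_of_frequently {E : Set ℝ} {θ : ℝ} (hθ0 : 0 ≤ θ) (hθ : θ < 1)
    (h : ∃ᶠ n : ℕ in atTop, ∃ T : Finset ℕ, T ⊆ Finset.range ⌊Real.exp ((1 - θ) * n)⌋₊ ∧
      ⌊Real.exp ((1 - θ) * n)⌋₊ ≤ 2 * T.card ∧
      ∀ j ∈ T, ∃ x ∈ E, Real.exp n + j * Real.exp (θ * n) ≤ x ∧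
        x < Real.exp n + (j + 1) * Real.exp (θ * n)) :
    ENNReal.ofReal (1 - θ) ≤ macroDim E := by
  refine le_iInf fun ρ => le_iInf fun hρ => le_iInf fun hfin => ?_
  by_contra hcon
  have hρθ : ρ ≤ 1 - θ := by
    by_contra h'
    exact hcon (ENNReal.ofReal_le_ofReal (not_le.1 h').le)
  -- Terms of a convergent series tend to 0, so a lower bound on the content along infinitely many
  -- shells is enough.
  have htend := ENNReal.tendsto_atTop_zero_of_tsum_ne_top hfin.ne
  have hev := htend.eventually (gt_mem_nhds
    (show (0 : ℝ≥0∞) < ENNReal.ofReal (1 / (12 * Real.exp 1)) from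
      ENNReal.ofReal_pos.2 (by positivity)))
  obtain ⟨n, ⟨T, hTJ, hT, hE⟩, hn⟩ := (h.and_eventually hev).exists
  exact absurd (le_shellContent_of_blocks hθ hρ hρθ hθ0 T hTJ hT hE) (not_le.2 hn)

end MacroDim

/-! ### Upper bounds for the peaks -/

section Upper

variable {Ω : Type*} [MeasurableSpace Ω] {P : Measure Ω} [IsProbabilityMeasure P]
  {X : ℝ → Ω → ℝ} {c K : ℝ}

/-- Borel–Cantelli over unit intervals: the supremum over [k, k+1] passes γ√(2 log k) with
probability O(k^{-2qγ²}), summable once q < 1/2 is so close to 1/2 that 2qγ² > 1. -/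
theorem IsDecorrelatingField.ae_eventually_lt (hX : IsDecorrelatingField P X c K) {γ : ℝ}
    (hγ : 1 < γ) : ∀ᵐ ω ∂P, ∀ᶠ x in atTop, |X x ω| < γ * √(2 * Real.log x) := by
  obtain ⟨q, hq1, hq2⟩ := exists_between (show 1 / (2 * γ ^ 2) < (1 : ℝ) / 2 by
    rw [div_lt_div_iff₀ (by positivity) (by norm_num)]; nlinarith)
  have hq0 : 0 < q := lt_trans (by positivity) hq1
  have hp : 1 < 2 * q * γ ^ 2 := by
    rw [div_lt_iff₀ (by positivity)] at hq1; linarith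
  obtain ⟨C, hC, hCb⟩ := hX.exists_measure_sup_le hq0.le hq2
  have hsum : ∑' k : ℕ, P {ω | ∃ x ∈ Icc ((k + 1 : ℕ) : ℝ) ((k + 1 : ℕ) + 1),
      γ * √(2 * Real.log (k + 1 : ℕ)) ≤ |X x ω|} ≠ ∞ := by
    have hle : ∀ k : ℕ, P {ω | ∃ x ∈ Icc ((k + 1 : ℕ) : ℝ) ((k + 1 : ℕ) + 1),
        γ * √(2 * Real.log (k + 1 : ℕ)) ≤ |X x ω|} ≤
        ENNReal.ofReal (C * (1 / ((k + 1 : ℕ) : ℝ) ^ (2 * q * γ ^ 2))) := by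
      intro k
      have hk : (1 : ℝ) ≤ ((k + 1 : ℕ) : ℝ) := by push_cast; linarith [Nat.cast_nonneg (α := ℝ) k]
      have hlog : 0 ≤ Real.log (k + 1 : ℕ) := Real.log_nonneg hk
      refine (hCb _ _ (by positivity)).trans (ENNReal.ofReal_le_ofReal (le_of_eq ?_))
      rw [mul_pow, Real.sq_sqrt (by positivity), Real.rpow_def_of_pos (by linarith), one_div,
        ← Real.exp_neg]
      congr 2
      ring
    refine ((ENNReal.tsum_le_tsum hle).trans_lt ?_).ne
    have hs : Summable fun k : ℕ => C * (1 / ((k + 1 : ℕ) : ℝ) ^ (2 * q * γ ^ 2)) :=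
      ((summable_nat_add_iff 1).2 (Real.summable_one_div_nat_rpow.2 hp)).mul_left C
    rw [← ENNReal.ofReal_tsum_of_nonneg (fun k => by positivity) hs]
    exact ENNReal.ofReal_lt_top
  filter_upwards [ae_eventually_notMem hsum] with ω hω
  obtain ⟨k0, hk0⟩ := eventually_atTop.1 hω
  filter_upwards [eventually_ge_atTop ((k0 + 1 : ℕ) : ℝ)] with x hx
  have hx1 : (1 : ℝ) ≤ x := le_trans (by push_cast; linarith [Nat.cast_nonneg (α := ℝ) k0]) hx
  have hfl : k0 + 1 ≤ ⌊x⌋₊ := Nat.le_floor hx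
  obtain ⟨k, hk⟩ : ∃ k, ⌊x⌋₊ = k + 1 := ⟨⌊x⌋₊ - 1, by omega⟩
  have h := hk0 k (by omega)
  have hxl : ((k + 1 : ℕ) : ℝ) ≤ x := by rw [← hk]; exact Nat.floor_le (by linarith)
  have hxu : x ≤ ((k + 1 : ℕ) : ℝ) + 1 := by rw [← hk]; exact (Nat.lt_floor_add_one x).le
  by_contra hcon
  refine h ⟨x, ⟨hxl, hxu⟩, le_trans ?_ (not_lt.1 hcon)⟩
  gcongr

/-- First moment: the shell is covered by the unit intervals that carry a peak. There are O(eⁿ)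
candidates, each of probability O(e^{-2qγ²n}) and cost e^{-(n+1)ρ}, so the expected contents form a
geometric series. -/
theorem IsDecorrelatingField.ae_tsum_shellContent_lt_top (hX : IsDecorrelatingField P X c K)
    {γ ρ : ℝ} (hγ : 0 ≤ γ) (hρ : 1 - γ ^ 2 < ρ) :
    ∀ᵐ ω ∂P, ∑' n : ℕ, shellContent (n + 1) ρ
      {x | 0 ≤ x ∧ γ * √(2 * Real.log x) ≤ |X x ω|} < ∞ := by
  obtain ⟨q, hq0, hq2, hqρ⟩ : ∃ q : ℝ, 0 ≤ q ∧ q < 1 / 2 ∧ 1 < 2 * q * γ ^ 2 + ρ := by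
    set η := ρ + γ ^ 2 - 1 with hη
    have hη0 : 0 < η := by linarith
    have hden : 0 < γ ^ 2 + 1 + η := by positivity
    -- The loss 2q = 1 - η/(γ²+1+η) costs less than η in 2qγ², and its denominator keeps q ≥ 0 even
    -- for large η or γ = 0.
    refine ⟨(1 - η / (γ ^ 2 + 1 + η)) / 2, ?_, ?_, ?_⟩
    · have : η / (γ ^ 2 + 1 + η) ≤ 1 := by rw [div_le_one hden]; nlinarith
      linarith
    · have : 0 < η / (γ ^ 2 + 1 + η) := by positivity
      linarith
    · have : η / (γ ^ 2 + 1 + η) * γ ^ 2 < η := by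
        rw [div_mul_eq_mul_div, div_lt_iff₀ hden]; nlinarith
      linarith
  obtain ⟨C, hC, hCb⟩ := hX.exists_measure_sup_le hq0 hq2
  -- Measurable hulls replace the supremum events, whose measurability is not assumed, at no cost in
  -- probability.
  let B : ℕ → ℕ → Set Ω := fun n k =>
    toMeasurable P {ω | ∃ x ∈ Icc (k : ℝ) (k + 1), γ * √(2 * n) ≤ |X x ω|}
  let M : ℕ → ℕ := fun n => ⌊Real.exp (n + 1)⌋₊ + 1
  let w : ℕ → ℝ≥0∞ := fun n => ENNReal.ofReal ((1 / Real.exp (n + 1 : ℕ)) ^ ρ)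
  let G : ℕ → Ω → ℝ≥0∞ := fun n ω => ∑ k ∈ Finset.range (M n), (B n k).indicator (fun _ => w n) ω
  have hGle : ∀ ω n, shellContent (n + 1) ρ {x | 0 ≤ x ∧ γ * √(2 * Real.log x) ≤ |X x ω|} ≤
      G n ω := by
    intro ω n
    classical
    refine (shellContent_le_card ((Finset.range (M n)).filter fun k => ω ∈ B n k) ?_).trans ?_
    · rintro x ⟨⟨hx0, hxX⟩, hxs⟩
      rw [mem_expShell_succ_of_nonneg hx0] at hxs
      refine mem_iUnion₂.2 ⟨⌊x⌋₊, ?_, Nat.floor_le hx0, Nat.lt_floor_add_one x⟩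
      refine Finset.mem_filter.2 ⟨Finset.mem_range.2 ?_, subset_toMeasurable _ _ ?_⟩
      · exact Nat.lt_succ_iff.2 (Nat.floor_le_floor hxs.2.le)
      · refine ⟨x, ⟨Nat.floor_le hx0, (Nat.lt_floor_add_one x).le⟩, le_trans ?_ hxX⟩
        have : (n : ℝ) ≤ Real.log x :=
          (Real.le_log_iff_exp_le ((Real.exp_pos _).trans_le hxs.1)).2 hxs.1
        gcongr
    · rw [Finset.sum_filter]
      refine Finset.sum_le_sum fun k _ => ?_
      by_cases hk : ω ∈ B n k <;> simp [hk, w]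
  have hGm : ∀ n, Measurable (G n) := fun n => Finset.measurable_fun_sum _ fun k _ =>
    measurable_const.indicator (measurableSet_toMeasurable _ _)
  have hGint : ∀ n, ∫⁻ ω, G n ω ∂P ≤ ENNReal.ofReal
      (2 * Real.exp 1 * C * Real.exp (-ρ) * Real.exp (-(2 * q * γ ^ 2 + ρ - 1)) ^ n) := by
    intro n
    simp only [G]
    rw [lintegral_finsetSum _ fun k _ =>
      measurable_const.indicator (measurableSet_toMeasurable _ _)]
    have hk : ∀ k, ∫⁻ ω, (B n k).indicator (fun _ => w n) ω ∂P ≤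
        ENNReal.ofReal ((1 / Real.exp (n + 1 : ℕ)) ^ ρ *
          (C * Real.exp (-(q * (γ * √(2 * n)) ^ 2)))) := by
      intro k
      rw [lintegral_indicator_const (measurableSet_toMeasurable _ _), measure_toMeasurable,
        ENNReal.ofReal_mul (by positivity)]
      gcongr
      exact hCb _ _ (by positivity)
    refine (Finset.sum_le_sum fun k _ => hk k).trans ?_
    rw [Finset.sum_const, Finset.card_range, ← ENNReal.ofReal_nsmul, nsmul_eq_mul]
    refine ENNReal.ofReal_le_ofReal ?_
    have hM : (M n : ℝ) ≤ 2 * Real.exp (n + 1) := by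
      have h1 : 1 ≤ Real.exp ((n : ℝ) + 1) := Real.one_le_exp (by positivity)
      have h2 := Nat.floor_le (Real.exp_pos ((n : ℝ) + 1)).le
      simp only [M]
      push_cast
      linarith
    have e1 : (1 / Real.exp (n + 1 : ℕ)) ^ ρ = Real.exp (-((n + 1) * ρ)) := by
      rw [one_div, ← Real.exp_neg, ← Real.exp_mul]; push_cast; congr 1; ring
    have e2 : q * (γ * √(2 * n)) ^ 2 = 2 * q * γ ^ 2 * n := by
      rw [mul_pow, Real.sq_sqrt (by positivity)]; ring
    rw [e1, e2]
    refine (mul_le_mul_of_nonneg_right hM (by positivity)).trans (le_of_eq ?_)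
    rw [← Real.exp_nat_mul]
    have e3 : 2 * Real.exp ((n : ℝ) + 1) * (Real.exp (-((n + 1) * ρ)) *
        (C * Real.exp (-(2 * q * γ ^ 2 * n)))) = 2 * C * (Real.exp ((n : ℝ) + 1) *
        Real.exp (-((n + 1) * ρ)) * Real.exp (-(2 * q * γ ^ 2 * n))) := by ring
    have e4 : 2 * Real.exp 1 * C * Real.exp (-ρ) *
        Real.exp (n * -(2 * q * γ ^ 2 + ρ - 1)) = 2 * C * (Real.exp 1 * Real.exp (-ρ) *
        Real.exp (n * -(2 * q * γ ^ 2 + ρ - 1))) := by ring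
    rw [e3, e4, ← Real.exp_add, ← Real.exp_add, ← Real.exp_add, ← Real.exp_add]
    congr 2
    ring
  have hfin : ∫⁻ ω, ∑' n, G n ω ∂P ≠ ∞ := by
    rw [lintegral_tsum fun n => (hGm n).aemeasurable]
    refine ((ENNReal.tsum_le_tsum hGint).trans_lt ?_).ne
    rw [← ENNReal.ofReal_tsum_of_nonneg (fun n => by positivity)
      ((summable_geometric_of_lt_one (by positivity)
        (Real.exp_lt_one_iff.2 (by linarith))).mul_left _)]
    exact ENNReal.ofReal_lt_top
  filter_upwards [ae_lt_top (Measurable.tsum hGm) hfin] with ω hω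
  exact (ENNReal.tsum_le_tsum fun n => hGle ω n).trans_lt hω

/-- The peaks of height `γ` have dimension at most `1 - γ²`. -/
theorem IsDecorrelatingField.ae_macroDim_le (hX : IsDecorrelatingField P X c K) {γ : ℝ}
    (hγ : 0 ≤ γ) (hγ1 : γ ≤ 1) :
    ∀ᵐ ω ∂P, macroDim {x | 0 ≤ x ∧ γ * √(2 * Real.log x) ≤ |X x ω|} ≤
      ENNReal.ofReal (1 - γ ^ 2) := by
  have h1 : 0 ≤ 1 - γ ^ 2 := by nlinarith
  have h : ∀ j : ℕ, ∀ᵐ ω ∂P, macroDim {x | 0 ≤ x ∧ γ * √(2 * Real.log x) ≤ |X x ω|} ≤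
      ENNReal.ofReal (1 - γ ^ 2 + 1 / ((j : ℝ) + 1)) := by
    intro j
    have hj : (0 : ℝ) < 1 / ((j : ℝ) + 1) := by positivity
    filter_upwards [hX.ae_tsum_shellContent_lt_top hγ
      (show 1 - γ ^ 2 < 1 - γ ^ 2 + 1 / ((j : ℝ) + 1) by linarith)] with ω hω
    exact macroDim_le (by linarith) hω
  filter_upwards [ae_all_iff.2 h] with ω hω
  have ht : Tendsto (fun j : ℕ => ENNReal.ofReal (1 - γ ^ 2 + 1 / ((j : ℝ) + 1))) atTop
      (𝓝 (ENNReal.ofReal (1 - γ ^ 2))) := by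
    refine (ENNReal.continuous_ofReal.tendsto _).comp ?_
    simpa using (tendsto_one_div_add_atTop_nhds_zero_nat (𝕜 := ℝ)).const_add (1 - γ ^ 2)
  exact ge_of_tendsto' ht hω

end Upper

/-! ### Lower bounds for the peaks -/

section Lower

variable {Ω : Type*} [MeasurableSpace Ω] {P : Measure Ω} {X : ℝ → Ω → ℝ} {c K : ℝ}

theorem IsDecorrelatingField.measureReal_le (hX : IsDecorrelatingField P X c K) (x a : ℝ) :
    P.real {ω | a ≤ X x ω} = (gaussianReal 0 1).real (Ici a) := by
  have h := HasGaussianLaw.map_eq_of_integral (hX.gaussian x x).fst (hX.mean x)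
  rw [hX.sq, Real.toNNReal_one] at h
  rw [← h, map_measureReal_apply_of_aemeasurable (hX.gaussian x x).fst.aemeasurable
    measurableSet_Ici]
  rfl

variable [IsProbabilityMeasure P]

/-- Events whose probabilities tend to zero fail infinitely often. -/
theorem ae_frequently_notMem_of_tendsto_zero {B : ℕ → Set Ω}
    (h : Tendsto (fun n => P.real (B n)) atTop (𝓝 0)) : ∀ᵐ ω ∂P, ∃ᶠ n in atTop, ω ∉ B n := by
  have hN : ∀ N : ℕ, ∀ᵐ ω ∂P, ∃ n ≥ N, ω ∉ B n := by
    intro N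
    rw [ae_iff]
    have hle : P.real {ω | ¬ ∃ n ≥ N, ω ∉ B n} ≤ 0 := by
      refine ge_of_tendsto h ?_
      filter_upwards [eventually_ge_atTop N] with n hn
      refine measureReal_mono (fun ω hω => ?_) (by finiteness)
      by_contra hcon
      exact hω ⟨n, hn, hcon⟩
    exact (measureReal_eq_zero_iff (by finiteness)).1 (le_antisymm hle measureReal_nonneg)
  filter_upwards [ae_all_iff.2 hN] with ω hω
  exact frequently_atTop.2 hω

/-- Markov's inequality for the number of occurring events. -/
theorem measureReal_lt_two_mul_card_le {J : ℕ} (hJ : 0 < J) (B : ℕ → Set Ω)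
    [∀ ω, DecidablePred fun j => ω ∈ B j] {f : ℝ} (hB : ∀ j < J, P.real (B j) ≤ f) :
    P.real {ω | J < 2 * ((Finset.range J).filter fun j => ω ∈ B j).card} ≤ 2 * f := by
  let N : Ω → ℝ := fun ω =>
    ∑ j ∈ Finset.range J, (toMeasurable P (B j)).indicator (fun _ => (1 : ℝ)) ω
  have hi : ∀ j, Integrable ((toMeasurable P (B j)).indicator (fun _ => (1 : ℝ))) P := fun j =>
    (integrable_const 1).indicator (measurableSet_toMeasurable _ _)
  have hN : ∫ ω, N ω ∂P ≤ J * f := by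
    simp only [N]
    rw [integral_finsetSum _ fun j _ => hi j]
    have : ∀ j ∈ Finset.range J,
        ∫ ω, (toMeasurable P (B j)).indicator (fun _ => (1 : ℝ)) ω ∂P ≤ f := by
      intro j hj
      rw [integral_indicator_const _ (measurableSet_toMeasurable _ _), smul_eq_mul, mul_one,
        measureReal_def, measure_toMeasurable]
      exact hB j (Finset.mem_range.1 hj)
    refine (Finset.sum_le_sum this).trans (le_of_eq ?_)
    simp
  have hN0 : ∀ ω, 0 ≤ N ω := fun ω => Finset.sum_nonneg fun j _ =>
    indicator_nonneg (fun _ _ => zero_le_one) _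
  have hmk := mul_meas_ge_le_integral_of_nonneg (ae_of_all P hN0)
    (integrable_finsetSum _ fun j _ => hi j) ((J : ℝ) / 2)
  have hsub : {ω | J < 2 * ((Finset.range J).filter fun j => ω ∈ B j).card} ⊆
      {ω | (J : ℝ) / 2 ≤ N ω} := by
    intro ω hω
    have h1 : (J : ℝ) < 2 * ((Finset.range J).filter fun j => ω ∈ B j).card := by
      exact_mod_cast hω
    have h2 : (((Finset.range J).filter fun j => ω ∈ B j).card : ℝ) ≤ N ω := by
      rw [Finset.card_filter]
      push_cast
      refine Finset.sum_le_sum fun j _ => ?_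
      by_cases hj : ω ∈ B j
      · simp [hj, indicator_of_mem (subset_toMeasurable P (B j) hj)]
      · simp only [hj, if_false]
        exact indicator_nonneg (fun _ _ => zero_le_one) _
    show (J : ℝ) / 2 ≤ N ω
    linarith
  have hJ' : (0 : ℝ) < J := Nat.cast_pos.2 hJ
  have h3 := (mul_le_mul_of_nonneg_left (measureReal_mono (μ := P) hsub (by finiteness))
    (by positivity : 0 ≤ (J : ℝ) / 2)).trans (hmk.trans hN)
  nlinarith

/-- The second moment bound for the probability that no site is high. -/
theorem IsDecorrelatingField.measureReal_forall_lt_le (hX : IsDecorrelatingField P X c K)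
    {ι : Type*} [DecidableEq ι] (s : Finset ι) (x a : ι → ℝ) (ha : ∀ i ∈ s, 0 ≤ a i)
    (hm : 0 < ∑ i ∈ s, (gaussianReal 0 1).real (Ici (a i))) :
    P.real {ω | ∀ i ∈ s, X (x i) ω < a i} ≤
      (∑ i ∈ s, (gaussianReal 0 1).real (Ici (a i)) +
        ∑ i ∈ s, ∑ j ∈ s.erase i, 4 * Real.exp (-(c / 2 * (x i - x j) ^ 2))) /
      (∑ i ∈ s, (gaussianReal 0 1).real (Ici (a i))) ^ 2 := by
  have hA : ∀ i ∈ s, NullMeasurableSet {ω | a i ≤ X (x i) ω} P := fun i _ =>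
    (hX.gaussian (x i) (x i)).fst.aemeasurable.nullMeasurable measurableSet_Ici
  have h := measureReal_biInter_compl_le (P := P) s (fun i => {ω | a i ≤ X (x i) ω}) hA
    (fun i j => 4 * Real.exp (-(c / 2 * (x i - x j) ^ 2))) (fun i hi j hj _ => ?_)
    (by simpa only [hX.measureReal_le] using hm)
  · simp only [hX.measureReal_le, mem_ofPred_eq, not_le] at h
    exact h
  · have h := measureReal_inter_le_of_corr_le (hX.gaussian (x i) (x j)) (hX.mean _) (hX.mean _)
      (hX.sq _) (hX.sq _) (Real.exp_pos _) (hX.corr_le (x i) (x j)) (a i) (ha j hj)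
    have e : √(Real.exp (-(c * (x i - x j) ^ 2))) = Real.exp (-(c / 2 * (x i - x j) ^ 2)) := by
      rw [Real.sqrt_eq_iff_mul_self_eq (Real.exp_pos _).le (Real.exp_pos _).le, ← Real.exp_add]
      congr 1; ring
    rwa [e] at h

/-- Cauchy condensation reduces this to the harmonic series. It supplies the divergence of the
expected number of high sites at the critical level. -/
theorem not_summable_one_div_mul_log :
    ¬ Summable fun n : ℕ => 1 / (((n : ℝ) + 2) * Real.log (n + 2)) := by
  intro h
  have hlog : ∀ n : ℕ, 0 < Real.log ((n : ℝ) + 2) := fun n =>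
    Real.log_pos (by linarith [Nat.cast_nonneg (α := ℝ) n])
  have h' := (summable_condensed_iff_of_nonneg
    (f := fun n : ℕ => 1 / (((n : ℝ) + 2) * Real.log (n + 2)))
    (fun n => by have := hlog n; positivity) (fun m n _ hmn => by
      have := hlog m
      have : (m : ℝ) ≤ n := Nat.cast_le.2 hmn
      gcongr)).2 h
  have hle : ∀ k : ℕ, 1 / 3 * (1 / ((k + 2 : ℕ) : ℝ)) ≤
      (2 : ℝ) ^ k * (1 / ((((2 ^ k : ℕ) : ℝ) + 2) * Real.log (((2 ^ k : ℕ) : ℝ) + 2))) := by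
    intro k
    have h2 : (1 : ℝ) ≤ 2 ^ k := one_le_pow₀ (by norm_num)
    push_cast
    have hl : Real.log ((2 : ℝ) ^ k + 2) ≤ (k : ℝ) + 2 := by
      have h3 : (2 : ℝ) ^ k + 2 ≤ 2 ^ (k + 2) := by rw [pow_add]; linarith
      refine (Real.log_le_log (by positivity) h3).trans ?_
      rw [Real.log_pow]
      push_cast
      have : Real.log 2 ≤ 1 := by linarith [Real.log_two_lt_d9]
      nlinarith [Nat.cast_nonneg (α := ℝ) k]
    have hl0 : 0 < Real.log ((2 : ℝ) ^ k + 2) := Real.log_pos (by linarith)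
    rw [mul_one_div, mul_one_div, div_div, div_le_div_iff₀ (by positivity) (by positivity), one_mul]
    calc ((2 : ℝ) ^ k + 2) * Real.log (2 ^ k + 2) ≤ (3 * 2 ^ k) * ((k : ℝ) + 2) := by
          gcongr; linarith
      _ = _ := by ring
  have h1 : Summable fun k : ℕ => 1 / 3 * (1 / ((k + 2 : ℕ) : ℝ)) :=
    Summable.of_nonneg_of_le (fun k => by positivity) hle h'
  rw [summable_mul_left_iff (by norm_num)] at h1
  exact Real.not_summable_one_div_natCast ((summable_nat_add_iff 2).1 h1)

/-- The critical peaks are unbounded. -/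
theorem IsDecorrelatingField.ae_frequently_le (hX : IsDecorrelatingField P X c K) (hc : 0 < c) :
    ∀ᵐ ω ∂P, ∃ᶠ x in atTop, √(2 * Real.log x) ≤ X x ω := by
  classical
  obtain ⟨c0, hc0, htail⟩ := exists_le_gaussianReal_Ici
  -- With c D²/2 = 3, sites at distance at least D√(log(k+2)) have correlation error at most
  -- (k+2)^{-3}, which splits into the summable product ((j+1)(k+1))^{-3/2}.
  set D := √(6 / c) with hD
  have hD0 : 0 < D := by positivity
  have hDc : c / 2 * D ^ 2 = 3 := by rw [hD, Real.sq_sqrt (by positivity)]; field_simp; norm_num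
  let l : ℕ → ℝ := fun k => √(Real.log ((k : ℝ) + 2))
  -- Sparse enough for summable correlation errors, yet dense enough: P(X(x) ≥ √(2 log x)) is at
  -- least of order 1/(x√(log x)), that is 1/(k log k) at these sites.
  let x : ℕ → ℝ := fun k => D * k * l k
  let a : ℕ → ℝ := fun k => √(2 * Real.log (x k))
  have hk2 : ∀ k : ℕ, (2 : ℝ) ≤ (k : ℝ) + 2 := fun k => by linarith [Nat.cast_nonneg (α := ℝ) k]
  have hlog : ∀ k : ℕ, 0 < Real.log ((k : ℝ) + 2) := fun k => Real.log_pos (by linarith [hk2 k])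
  have hl0 : ∀ k, 0 < l k := fun k => Real.sqrt_pos.2 (hlog k)
  have hlmono : Monotone l := fun j k hjk => Real.sqrt_le_sqrt
    (Real.log_le_log (by linarith [hk2 j]) (by have : (j : ℝ) ≤ k := Nat.cast_le.2 hjk; linarith))
  have hl_atTop : Tendsto l atTop atTop := by
    refine Real.tendsto_sqrt_atTop.comp (Real.tendsto_log_atTop.comp ?_)
    exact tendsto_atTop_add_const_right _ _ tendsto_natCast_atTop_atTop
  have hx_atTop : Tendsto x atTop atTop := by
    refine Tendsto.atTop_mul_atTop₀ ?_ hl_atTop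
    exact tendsto_natCast_atTop_atTop.const_mul_atTop hD0
  have hlt : ∀ j k : ℕ, j < k → Real.exp (-(c / 2 * (x j - x k) ^ 2)) ≤
      ((j : ℝ) + 1) ^ (-(3 / 2) : ℝ) * ((k : ℝ) + 1) ^ (-(3 / 2) : ℝ) := by
    intro j k hjk
    have hjk' : (j : ℝ) + 1 ≤ k := by exact_mod_cast hjk
    have hd : D * l k ≤ x k - x j := by
      have h1 : D * j * l j ≤ D * j * l k := by gcongr; exact hlmono hjk.le
      have h2 : D * l k * (j + 1) ≤ D * l k * k := by
        have := hl0 k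
        gcongr
      simp only [x]
      linarith
    have h1 : (D * l k) ^ 2 ≤ (x j - x k) ^ 2 := by
      have : (x j - x k) ^ 2 = (x k - x j) ^ 2 := by ring
      rw [this]
      have := hl0 k
      gcongr
    have h2 : c / 2 * (D * l k) ^ 2 = 3 * Real.log ((k : ℝ) + 2) := by
      rw [mul_pow, ← mul_assoc, hDc, Real.sq_sqrt (hlog k).le]
    have hj1 : (0 : ℝ) < (j : ℝ) + 1 := by positivity
    have hk1 : (0 : ℝ) < (k : ℝ) + 1 := by positivity
    rw [Real.rpow_def_of_pos hj1, Real.rpow_def_of_pos hk1, ← Real.exp_add, Real.exp_le_exp]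
    have h3 : Real.log ((j : ℝ) + 1) ≤ Real.log ((k : ℝ) + 2) :=
      Real.log_le_log hj1 (by linarith)
    have h4 : Real.log ((k : ℝ) + 1) ≤ Real.log ((k : ℝ) + 2) :=
      Real.log_le_log hk1 (by linarith)
    have h5 := mul_le_mul_of_nonneg_left h1 (show 0 ≤ c / 2 by positivity)
    rw [h2] at h5
    linarith
  have hne : ∀ j k : ℕ, j ≠ k → Real.exp (-(c / 2 * (x j - x k) ^ 2)) ≤
      ((j : ℝ) + 1) ^ (-(3 / 2) : ℝ) * ((k : ℝ) + 1) ^ (-(3 / 2) : ℝ) := by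
    intro j k hjk
    rcases lt_or_gt_of_ne hjk with h | h
    · exact hlt j k h
    · rw [show (x j - x k) ^ 2 = (x k - x j) ^ 2 by ring, mul_comm (_ ^ _)]
      exact hlt k j h
  have hs : Summable fun k : ℕ => ((k : ℝ) + 1) ^ (-(3 / 2) : ℝ) := by
    have h := (summable_nat_add_iff 1).2
      (Real.summable_nat_rpow.2 (show (-(3 / 2) : ℝ) < -1 by norm_num))
    refine h.congr fun k => by push_cast; rfl
  set S := ∑' k : ℕ, ((k : ℝ) + 1) ^ (-(3 / 2) : ℝ) with hS
  obtain ⟨N0, hN0⟩ : ∃ N0 : ℕ, ∀ k ≥ N0, Real.exp 1 ≤ x k ∧ D ≤ (k : ℝ) + 2 := by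
    refine eventually_atTop.1 ((hx_atTop.eventually_ge_atTop _).and ?_)
    have : Tendsto (fun k : ℕ => (k : ℝ) + 2) atTop atTop :=
      tendsto_atTop_add_const_right _ _ tendsto_natCast_atTop_atTop
    exact this.eventually_ge_atTop D
  have hp : ∀ k ≥ N0, c0 / (3 * D) * (1 / (((k : ℝ) + 2) * Real.log (k + 2))) ≤
      (gaussianReal 0 1).real (Ici (a k)) := by
    intro k hk
    obtain ⟨hxe, hDk⟩ := hN0 k hk
    have hx0 : 0 < x k := (Real.exp_pos _).trans_le hxe
    have hlx : 1 ≤ Real.log (x k) := (Real.le_log_iff_exp_le hx0).2 hxe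
    have ha1 : 1 ≤ a k := Real.one_le_sqrt.2 (by linarith)
    refine le_trans ?_ (htail (a k) ha1)
    have hasq : a k ^ 2 = 2 * Real.log (x k) := Real.sq_sqrt (by linarith)
    have e1 : Real.exp (-a k ^ 2 / 2) = 1 / x k := by
      rw [hasq, show -(2 * Real.log (x k)) / 2 = -Real.log (x k) by ring, Real.exp_neg,
        Real.exp_log hx0, one_div]
    have hlk : l k ≤ (k : ℝ) + 2 := by
      refine Real.sqrt_le_iff.2 ⟨by positivity, ?_⟩
      have := Real.log_le_sub_one_of_pos (show (0 : ℝ) < (k : ℝ) + 2 by positivity)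
      nlinarith [hk2 k]
    have hxle : x k ≤ ((k : ℝ) + 2) ^ 3 := by
      have := (hl0 k).le
      have h1 : D * k * l k ≤ ((k : ℝ) + 2) * ((k : ℝ) + 2) * ((k : ℝ) + 2) := by
        gcongr
        linarith
      calc x k ≤ _ := h1
        _ = _ := by ring
    have hale : a k ≤ 3 * l k := by
      refine Real.sqrt_le_iff.2 ⟨by linarith [hl0 k], ?_⟩
      rw [mul_pow, Real.sq_sqrt (hlog k).le]
      have h1 := Real.log_le_log hx0 hxle
      rw [Real.log_pow] at h1
      push_cast at h1
      linarith [hlog k]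
    have h1 : a k * x k ≤ 3 * D * (((k : ℝ) + 2) * Real.log (k + 2)) := by
      have h2 : l k * l k = Real.log ((k : ℝ) + 2) := Real.mul_self_sqrt (hlog k).le
      have hlk0 := (hl0 k).le
      calc a k * x k ≤ 3 * l k * (D * ((k : ℝ) + 2) * l k) := by
            refine mul_le_mul hale ?_ hx0.le (by positivity)
            simp only [x]
            gcongr
            linarith
        _ = 3 * D * (((k : ℝ) + 2) * (l k * l k)) := by ring
        _ = _ := by rw [h2]
    rw [e1, div_mul_div_comm, div_mul_div_comm, mul_one]
    gcongr
  have hmain : ∀ N ≥ N0, ∀ᵐ ω ∂P, ∃ k ≥ N, a k ≤ X (x k) ω := by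
    intro N hN
    let m : ℕ → ℝ := fun M => ∑ k ∈ Finset.Ico N M, (gaussianReal 0 1).real (Ici (a k))
    have hm : Tendsto m atTop atTop := by
      have h1 : Tendsto (fun M => ∑ k ∈ Finset.range M,
          c0 / (3 * D) * (1 / ((((k + N : ℕ) : ℝ) + 2) * Real.log ((k + N : ℕ) + 2)))) atTop
          atTop := by
        refine (not_summable_iff_tendsto_nat_atTop_of_nonneg fun k => ?_).1 ?_
        · have := hlog (k + N)
          positivity
        · rw [summable_mul_left_iff (by positivity)]
          exact fun h => not_summable_one_div_mul_log ((summable_nat_add_iff N).1 h)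
      refine (tendsto_add_atTop_iff_nat N).1 (tendsto_atTop_mono (fun M => ?_) h1)
      simp only [m]
      rw [Finset.sum_Ico_eq_sum_range, Nat.add_sub_cancel]
      refine Finset.sum_le_sum fun k _ => ?_
      rw [add_comm N k]
      exact hp (k + N) (by omega)
    have htend : Tendsto (fun M => P.real {ω | ∀ k ∈ Finset.Ico N M, X (x k) ω < a k}) atTop
        (𝓝 0) := by
      -- The second moment bound is 1/m + 4S²/m², with m → ∞ and total correlation error at most
      -- 4S².
      have hz : Tendsto (fun M => (m M)⁻¹ + 4 * S ^ 2 * ((m M)⁻¹ * (m M)⁻¹)) atTop (𝓝 0) := by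
        have := tendsto_inv_atTop_zero.comp hm
        simpa using this.add ((this.mul this).const_mul (4 * S ^ 2))
      refine squeeze_zero' (Eventually.of_forall fun _ => measureReal_nonneg) ?_ hz
      filter_upwards [hm.eventually_gt_atTop 0] with M hM
      refine (hX.measureReal_forall_lt_le (Finset.Ico N M) x a (fun _ _ => Real.sqrt_nonneg _)
        hM).trans ?_
      have hE : ∑ i ∈ Finset.Ico N M, ∑ j ∈ (Finset.Ico N M).erase i,
          4 * Real.exp (-(c / 2 * (x i - x j) ^ 2)) ≤ 4 * S ^ 2 := by
        have hle : ∀ s : Finset ℕ, ∑ k ∈ s, ((k : ℝ) + 1) ^ (-(3 / 2) : ℝ) ≤ S := fun s =>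
          hs.sum_le_tsum s fun k _ => by positivity
        have hS0 : 0 ≤ S := tsum_nonneg fun k => by positivity
        calc ∑ i ∈ Finset.Ico N M, ∑ j ∈ (Finset.Ico N M).erase i,
              4 * Real.exp (-(c / 2 * (x i - x j) ^ 2))
            ≤ ∑ i ∈ Finset.Ico N M, 4 * ((i : ℝ) + 1) ^ (-(3 / 2) : ℝ) * S := by
              refine Finset.sum_le_sum fun i _ => ?_
              refine le_trans ?_ (mul_le_mul_of_nonneg_left (hle ((Finset.Ico N M).erase i))
                (by positivity))
              rw [Finset.mul_sum]
              refine Finset.sum_le_sum fun j hj => ?_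
              rw [mul_assoc]
              have := hne i j (Finset.ne_of_mem_erase hj).symm
              linarith
          _ = 4 * (∑ i ∈ Finset.Ico N M, ((i : ℝ) + 1) ^ (-(3 / 2) : ℝ)) * S := by
              rw [← Finset.sum_mul, Finset.mul_sum]
          _ ≤ 4 * S * S := by gcongr; exact hle _
          _ = 4 * S ^ 2 := by ring
      change (m M + _) / m M ^ 2 ≤ _
      have e : (m M)⁻¹ + 4 * S ^ 2 * ((m M)⁻¹ * (m M)⁻¹) = (m M + 4 * S ^ 2) / m M ^ 2 := by
        field_simp
      rw [e]
      gcongr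
    filter_upwards [ae_frequently_notMem_of_tendsto_zero htend] with ω hω
    obtain ⟨M, hM⟩ := hω.exists
    simp only [not_forall, not_lt] at hM
    obtain ⟨k, hk, hak⟩ := hM
    exact ⟨k, (Finset.mem_Ico.1 hk).1, hak⟩
  have hall : ∀ᵐ ω ∂P, ∀ N ≥ N0, ∃ k ≥ N, a k ≤ X (x k) ω := by
    rw [ae_all_iff]
    intro N
    by_cases hN : N ≥ N0
    · filter_upwards [hmain N hN] with ω hω _ using hω
    · exact ae_of_all _ fun ω h => absurd h hN
  filter_upwards [hall] with ω hω
  have hfr : ∃ᶠ k in atTop, a k ≤ X (x k) ω := by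
    refine frequently_atTop.2 fun N => ?_
    obtain ⟨k, hk, hak⟩ := hω (max N N0) (le_max_right _ _)
    exact ⟨k, (le_max_left _ _).trans hk, hak⟩
  exact hx_atTop.frequently hfr

/-! ### The dimension of the peaks from below -/

theorem tendsto_sq_mul_exp_neg {δ : ℝ} (hδ : 0 < δ) :
    Tendsto (fun n : ℕ => ((n : ℝ) + 1) ^ 2 * Real.exp (-(δ * n))) atTop (𝓝 0) := by
  have h1 : Tendsto (fun n : ℕ => δ * ((n : ℝ) + 1)) atTop atTop :=
    (tendsto_atTop_add_const_right _ _ tendsto_natCast_atTop_atTop).const_mul_atTop hδ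
  have h2 := ((Real.tendsto_pow_mul_exp_neg_atTop_nhds_zero 2).comp h1).const_mul
    (Real.exp δ / δ ^ 2)
  rw [mul_zero] at h2
  refine h2.congr fun n => ?_
  simp only [Function.comp_apply]
  rw [show -(δ * ((n : ℝ) + 1)) = -(δ * n) + -δ by ring, Real.exp_add, Real.exp_neg δ]
  field_simp

/-- The peaks of height `γ` meet most blocks of length `e^{θ n}` when `γ² < θ`. -/
theorem IsDecorrelatingField.ae_one_sub_le_macroDim (hX : IsDecorrelatingField P X c K)
    (hc : 0 < c) {γ θ : ℝ} (hγ : 0 < γ) (hγθ : γ ^ 2 < θ) (hθ : θ < 1) (x0 : ℝ) :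
    ∀ᵐ ω ∂P, ENNReal.ofReal (1 - θ) ≤
      macroDim {x | x0 ≤ x ∧ γ * √(2 * Real.log x) < X x ω} := by
  classical
  obtain ⟨c0, hc0, htail⟩ := exists_le_gaussianReal_Ici
  have hθ0 : 0 < θ := lt_of_le_of_lt (sq_nonneg γ) hγθ
  have hγ1 : γ ≤ 1 := by nlinarith
  -- Each block of length e^{θn} is sampled at `M n` sites with spacing n, and `J n` such blocks fit
  -- into the stretch [eⁿ, 2eⁿ] of the shell.
  let M : ℕ → ℕ := fun n => ⌊Real.exp (θ * n) / n⌋₊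
  let J : ℕ → ℕ := fun n => ⌊Real.exp ((1 - θ) * n)⌋₊
  -- On the shell log x < n + 1, so this level exceeds the gauge level at every site.
  let a : ℕ → ℝ := fun n => γ * √(2 * ((n : ℝ) + 1))
  let p : ℕ → ℝ := fun n => (gaussianReal 0 1).real (Ici (a n))
  let y : ℕ → ℕ → ℕ → ℝ := fun n j i => Real.exp n + j * Real.exp (θ * n) + i * n
  let B : ℕ → ℕ → Set Ω := fun n j => {ω | ∀ i ∈ Finset.range (M n), X (y n j i) ω < a n}
  -- The second moment bound for a block without high sites. It tends to 0: M p is at least of order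
  -- e^{(θ-γ²)n}/n², and the spacing n makes the correlation error e^{-cn²/2} negligible against p².
  let f : ℕ → ℝ := fun n => 1 / (M n * p n) + 4 * Real.exp (-(c / 2 * (n : ℝ) ^ 2)) / p n ^ 2
  have hJ : ∀ n, 0 < J n := fun n => Nat.floor_pos.2
    (Real.one_le_exp (mul_nonneg (by linarith) (Nat.cast_nonneg n)))
  have hn_atTop : Tendsto (fun n : ℕ => (n : ℝ)) atTop atTop := tendsto_natCast_atTop_atTop
  set c1 := c0 / 2 * Real.exp (-γ ^ 2) with hc1
  have hc10 : 0 < c1 := by positivity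
  have hp : ∀ᶠ n : ℕ in atTop, c1 / ((n : ℝ) + 1) * Real.exp (-(γ ^ 2 * n)) ≤ p n := by
    filter_upwards [hn_atTop.eventually_ge_atTop (1 / γ ^ 2)] with n hn
    have hn0 : (0 : ℝ) ≤ n := Nat.cast_nonneg n
    have hasq : a n ^ 2 = 2 * γ ^ 2 * (n + 1) := by
      simp only [a]; rw [mul_pow, Real.sq_sqrt (by positivity)]; ring
    have ha0 : 0 ≤ a n := by positivity
    rw [div_le_iff₀ (by positivity)] at hn
    have ha1 : 1 ≤ a n := by nlinarith [sq_nonneg γ]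
    have ha2 : a n ≤ 2 * ((n : ℝ) + 1) := by
      refine abs_le_of_sq_le_sq' ?_ (by positivity) |>.2
      rw [hasq]
      nlinarith [sq_nonneg γ]
    refine le_trans ?_ (htail (a n) ha1)
    have e : Real.exp (-a n ^ 2 / 2) = Real.exp (-γ ^ 2) * Real.exp (-(γ ^ 2 * n)) := by
      rw [hasq, ← Real.exp_add]; congr 1; ring
    rw [e, hc1, ← mul_assoc]
    refine mul_le_mul_of_nonneg_right ?_ (Real.exp_pos _).le
    rw [mul_div_right_comm, div_div]
    gcongr
  have hM : ∀ᶠ n : ℕ in atTop, Real.exp (θ * n) / (2 * ((n : ℝ) + 1)) ≤ M n := by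
    have ht := Real.tendsto_exp_div_pow_atTop 1
    have ht2 := (ht.comp (hn_atTop.const_mul_atTop hθ0)).eventually_ge_atTop (1 / θ)
    filter_upwards [ht2, eventually_gt_atTop 0] with n hn hn0
    have hn0' : (0 : ℝ) < n := Nat.cast_pos.2 hn0
    have h1 : 1 ≤ Real.exp (θ * n) / n := by
      simp only [Function.comp_apply, pow_one] at hn
      rw [div_le_div_iff₀ hθ0 (by positivity)] at hn
      rw [le_div_iff₀ hn0']
      nlinarith
    have h2 := Nat.lt_floor_add_one (Real.exp (θ * n) / n)
    have h3 : (1 : ℝ) ≤ (M n : ℝ) := by exact_mod_cast (Nat.one_le_floor_iff _).2 h1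
    have h4 : Real.exp (θ * n) / (2 * ((n : ℝ) + 1)) ≤ Real.exp (θ * n) / n / 2 := by
      rw [div_div, mul_comm (n : ℝ) 2]
      gcongr
      linarith
    change Real.exp (θ * n) / n < M n + 1 at h2
    linarith
  have hf : Tendsto f atTop (𝓝 0) := by
    have ht1 := (tendsto_sq_mul_exp_neg (sub_pos.2 hγθ)).const_mul (2 / c1)
    have ht2 := (tendsto_sq_mul_exp_neg one_pos).const_mul (4 / c1 ^ 2)
    have ht := ht1.add ht2
    simp only [mul_zero, add_zero] at ht
    refine squeeze_zero' (Eventually.of_forall fun n => by positivity) ?_ ht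
    filter_upwards [hp, hM, hn_atTop.eventually_ge_atTop (2 * (2 * γ ^ 2 + 1) / c)] with n hpn hMn hn
    have hlow : 0 < c1 / ((n : ℝ) + 1) * Real.exp (-(γ ^ 2 * n)) := by positivity
    have hpn0 : 0 < p n := hlow.trans_le hpn
    refine add_le_add ?_ ?_
    · have h1 : Real.exp (θ * n) / (2 * ((n : ℝ) + 1)) *
          (c1 / ((n : ℝ) + 1) * Real.exp (-(γ ^ 2 * n))) ≤ M n * p n := by gcongr
      have h2 := one_div_le_one_div_of_le (by positivity) h1
      refine h2.trans (le_of_eq ?_)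
      rw [show -((θ - γ ^ 2) * n) = -(θ * n) + γ ^ 2 * n by ring, Real.exp_add, Real.exp_neg,
        Real.exp_neg]
      field_simp
    · have h1 : (c1 / ((n : ℝ) + 1) * Real.exp (-(γ ^ 2 * n))) ^ 2 ≤ p n ^ 2 := by gcongr
      have h2 : 4 * Real.exp (-(c / 2 * (n : ℝ) ^ 2)) / p n ^ 2 ≤
          4 * Real.exp (-(c / 2 * (n : ℝ) ^ 2)) /
            (c1 / ((n : ℝ) + 1) * Real.exp (-(γ ^ 2 * n))) ^ 2 := by gcongr
      have h3 : Real.exp (-(c / 2 * (n : ℝ) ^ 2)) ≤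
          Real.exp (-(1 * n)) * Real.exp (-(γ ^ 2 * n)) ^ 2 := by
        rw [← Real.exp_nat_mul, ← Real.exp_add, Real.exp_le_exp]
        rw [div_le_iff₀ hc] at hn
        have hn0 : (0 : ℝ) ≤ n := Nat.cast_nonneg n
        push_cast
        nlinarith
      refine h2.trans ?_
      rw [div_le_iff₀ (by positivity)]
      calc 4 * Real.exp (-(c / 2 * (n : ℝ) ^ 2))
          ≤ 4 * (Real.exp (-(1 * n)) * Real.exp (-(γ ^ 2 * n)) ^ 2) := by gcongr
        _ = _ := by field_simp
  have hB : ∀ᶠ n : ℕ in atTop, ∀ j, P.real (B n j) ≤ f n := by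
    filter_upwards [hp, hM] with n hpn hMn j
    have hpn0 : 0 < p n := lt_of_lt_of_le (by positivity) hpn
    have hMn0 : (0 : ℝ) < M n := lt_of_lt_of_le (by positivity) hMn
    have hsum : ∑ _i ∈ Finset.range (M n), (gaussianReal 0 1).real (Ici (a n)) = M n * p n := by
      simp [p]
    have h := hX.measureReal_forall_lt_le (Finset.range (M n)) (y n j) (fun _ => a n)
      (fun _ _ => by positivity) (by rw [hsum]; positivity)
    rw [hsum] at h
    refine h.trans ?_
    have hE : ∑ i ∈ Finset.range (M n), ∑ i' ∈ (Finset.range (M n)).erase i,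
        4 * Real.exp (-(c / 2 * (y n j i - y n j i') ^ 2)) ≤
        (M n : ℝ) ^ 2 * (4 * Real.exp (-(c / 2 * (n : ℝ) ^ 2))) := by
      have hterm : ∀ i ∈ Finset.range (M n), ∑ i' ∈ (Finset.range (M n)).erase i,
          4 * Real.exp (-(c / 2 * (y n j i - y n j i') ^ 2)) ≤
          M n * (4 * Real.exp (-(c / 2 * (n : ℝ) ^ 2))) := by
        intro i _
        refine (Finset.sum_le_card_nsmul _ _ (4 * Real.exp (-(c / 2 * (n : ℝ) ^ 2))) fun i' hi' =>
          ?_).trans ?_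
        · have hne : (i : ℤ) - i' ≠ 0 :=
            sub_ne_zero.2 fun h => (Finset.ne_of_mem_erase hi') (Int.ofNat_inj.1 h).symm
          have h1 : (1 : ℝ) ≤ ((i : ℝ) - i') ^ 2 := by
            have h2 : (1 : ℤ) ≤ ((i : ℤ) - i') ^ 2 := by
              have := sq_pos_of_ne_zero hne
              omega
            exact_mod_cast h2
          have e : (y n j i - y n j i') ^ 2 = ((i : ℝ) - i') ^ 2 * (n : ℝ) ^ 2 := by
            simp only [y]; ring
          rw [e]
          gcongr
          exact le_mul_of_one_le_left (sq_nonneg _) h1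
        · rw [nsmul_eq_mul]
          have hcard : ((Finset.range (M n)).erase i).card ≤ M n :=
            (Finset.card_erase_le).trans (by simp)
          have : (((Finset.range (M n)).erase i).card : ℝ) ≤ M n := Nat.cast_le.2 hcard
          gcongr
      refine (Finset.sum_le_sum hterm).trans (le_of_eq ?_)
      rw [Finset.sum_const, Finset.card_range, nsmul_eq_mul]
      ring
    have h2 : (M n * p n + ∑ i ∈ Finset.range (M n), ∑ i' ∈ (Finset.range (M n)).erase i,
        4 * Real.exp (-(c / 2 * (y n j i - y n j i') ^ 2))) / (M n * p n) ^ 2 ≤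
        (M n * p n + (M n : ℝ) ^ 2 * (4 * Real.exp (-(c / 2 * (n : ℝ) ^ 2)))) /
          (M n * p n) ^ 2 := by gcongr
    refine h2.trans (le_of_eq ?_)
    simp only [f]
    field_simp
  have hbad : Tendsto (fun n => P.real {ω | J n <
      2 * ((Finset.range (J n)).filter fun j => ω ∈ B n j).card}) atTop (𝓝 0) := by
    refine squeeze_zero' (Eventually.of_forall fun _ => measureReal_nonneg) ?_
      (by simpa using hf.const_mul 2)
    filter_upwards [hB] with n hn
    exact measureReal_lt_two_mul_card_le (hJ n) (B n) fun j _ => hn j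
  filter_upwards [ae_frequently_notMem_of_tendsto_zero hbad] with ω hω
  refine le_macroDim_of_frequently hθ0.le hθ ?_
  have hexp : ∀ᶠ n : ℕ in atTop, x0 ≤ Real.exp n :=
    (Real.tendsto_exp_atTop.comp hn_atTop).eventually_ge_atTop x0
  refine (hω.and_eventually (hexp.and (eventually_gt_atTop 0))).mono ?_
  rintro n ⟨hgood, hx0, hn0⟩
  have hn0' : (0 : ℝ) < n := Nat.cast_pos.2 hn0
  simp only [not_lt] at hgood
  refine ⟨(Finset.range (J n)).filter fun j => ω ∉ B n j, Finset.filter_subset _ _, ?_, ?_⟩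
  · have h := Finset.card_filter_add_card_filter_not (s := Finset.range (J n)) (fun j => ω ∈ B n j)
    rw [Finset.card_range] at h
    change J n ≤ _
    omega
  · intro j hj
    obtain ⟨hjJ, hjB⟩ := Finset.mem_filter.1 hj
    simp only [B, mem_ofPred_eq, not_forall, not_lt] at hjB
    obtain ⟨i, hi, hai⟩ := hjB
    have hL : 0 < Real.exp (θ * n) := Real.exp_pos _
    have hi1 : ((i : ℝ) + 1) * n ≤ Real.exp (θ * n) := by
      have h1 : i + 1 ≤ M n := Finset.mem_range.1 hi
      have h2 : ((i : ℝ) + 1) ≤ (M n : ℝ) := by exact_mod_cast h1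
      have h3 : (M n : ℝ) ≤ Real.exp (θ * n) / n := Nat.floor_le (by positivity)
      exact (le_div_iff₀ hn0').1 (h2.trans h3)
    have hlo : Real.exp n + j * Real.exp (θ * n) ≤ y n j i := by
      simp only [y]
      have : 0 ≤ (i : ℝ) * n := by positivity
      linarith
    have hup : y n j i < Real.exp n + (j + 1) * Real.exp (θ * n) := by
      simp only [y]
      linarith
    have hjR : ((j : ℝ) + 1) * Real.exp (θ * n) ≤ Real.exp n := by
      have h1 : j + 1 ≤ J n := Finset.mem_range.1 hjJ
      have h2 : ((j : ℝ) + 1) ≤ (J n : ℝ) := by exact_mod_cast h1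
      have h3 : (J n : ℝ) ≤ Real.exp ((1 - θ) * n) := Nat.floor_le (Real.exp_pos _).le
      calc ((j : ℝ) + 1) * Real.exp (θ * n) ≤ Real.exp ((1 - θ) * n) * Real.exp (θ * n) := by
            gcongr; exact h2.trans h3
        _ = Real.exp n := by rw [← Real.exp_add]; congr 1; ring
    have hy0 : Real.exp n ≤ y n j i := by
      have : 0 ≤ (j : ℝ) * Real.exp (θ * n) := by positivity
      linarith
    have hypos : 0 < y n j i := (Real.exp_pos _).trans_le hy0
    have hlogy : Real.log (y n j i) < n + 1 := by
      rw [Real.log_lt_iff_lt_exp hypos, Real.exp_add]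
      have := Real.add_one_le_exp (1 : ℝ)
      nlinarith [Real.exp_pos (n : ℝ)]
    refine ⟨y n j i, ⟨hx0.trans hy0, lt_of_lt_of_le ?_ hai⟩, hlo, hup⟩
    refine mul_lt_mul_of_pos_left (Real.sqrt_lt_sqrt ?_ (by linarith)) hγ
    have : 0 ≤ Real.log (y n j i) := Real.log_nonneg ((Real.one_le_exp hn0'.le).trans hy0)
    positivity

/-- The peaks of height `γ` have dimension at least `1 - γ²`. -/
theorem IsDecorrelatingField.ae_le_macroDim (hX : IsDecorrelatingField P X c K)
    (hc : 0 < c) {γ : ℝ} (hγ : 0 < γ) (x0 : ℝ) :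
    ∀ᵐ ω ∂P, ENNReal.ofReal (1 - γ ^ 2) ≤
      macroDim {x | x0 ≤ x ∧ γ * √(2 * Real.log x) < X x ω} := by
  rcases le_or_gt 1 γ with h1 | h1
  · refine ae_of_all _ fun ω => ?_
    rw [ENNReal.ofReal_of_nonpos (by nlinarith)]
    exact zero_le
  have hγ2 : γ ^ 2 < 1 := by nlinarith
  -- Here θ decreases to γ² along a sequence; j + 2 rather than j + 1 keeps θ < 1 at j = 0.
  have h : ∀ j : ℕ, ∀ᵐ ω ∂P, ENNReal.ofReal ((1 - γ ^ 2) * (1 - 1 / ((j : ℝ) + 2))) ≤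
      macroDim {x | x0 ≤ x ∧ γ * √(2 * Real.log x) < X x ω} := by
    intro j
    have hj : (0 : ℝ) < 1 / ((j : ℝ) + 2) := by positivity
    have hj1 : 1 / ((j : ℝ) + 2) < 1 := by
      rw [div_lt_one (by positivity)]; linarith [Nat.cast_nonneg (α := ℝ) j]
    have := hX.ae_one_sub_le_macroDim hc hγ
      (θ := 1 - (1 - γ ^ 2) * (1 - 1 / ((j : ℝ) + 2))) (by nlinarith) (by nlinarith) x0
    simpa only [sub_sub_cancel] using this
  filter_upwards [ae_all_iff.2 h] with ω hω
  have ht : Tendsto (fun j : ℕ => ENNReal.ofReal ((1 - γ ^ 2) * (1 - 1 / ((j : ℝ) + 2)))) atTop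
      (𝓝 (ENNReal.ofReal (1 - γ ^ 2))) := by
    refine (ENNReal.continuous_ofReal.tendsto _).comp ?_
    have h1 : Tendsto (fun j : ℕ => 1 / ((j : ℝ) + 2)) atTop (𝓝 0) := by
      simp only [one_div]
      exact tendsto_inv_atTop_zero.comp
        (tendsto_atTop_add_const_right _ _ tendsto_natCast_atTop_atTop)
    simpa using (h1.const_sub 1).const_mul (1 - γ ^ 2)
  exact le_of_tendsto' ht hω

end Lower

/-! ### Peaks and moments of the linear stochastic heat equation -/

section Peaks

variable {Ω : Type*} [MeasurableSpace Ω] {P : Measure Ω}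

theorem heatPeaks_eq {t : ℝ} (ht : 0 < t) (z : ℝ → ℝ) (γ : ℝ) :
    heatPeaks t z γ = {x | Real.exp (Real.exp 1) ≤ x ∧
      γ * √(2 * Real.log x) ≤ (Real.pi / t) ^ (1 / 4 : ℝ) * z x} := by
  ext x
  simp only [heatPeaks, mem_ofPred_eq]
  refine and_congr_right fun hx => ?_
  have hx1 : 1 < x := (Real.one_lt_exp_iff.2 (Real.exp_pos 1)).trans_le hx
  have hg : 0 < √(2 * Real.log x) := Real.sqrt_pos.2 (mul_pos two_pos (Real.log_pos hx1))
  have hκ : 0 < (Real.pi / t) ^ (1 / 4 : ℝ) := by positivity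
  have e : (t / Real.pi) ^ (1 / 4 : ℝ) = ((Real.pi / t) ^ (1 / 4 : ℝ))⁻¹ := by
    rw [← Real.inv_rpow (by positivity), inv_div]
  rw [e, le_div_iff₀ hg, ← div_eq_mul_inv, div_mul_eq_mul_div, div_le_iff₀ hκ, mul_comm (z x)]

/-- Where log x is negative, `Real.sqrt` returns 0, so the plain logarithm can replace log₊ under
the root. -/
theorem sqrt_two_mul_posLog (x : ℝ) : √(2 * Real.posLog x) = √(2 * Real.log x) := by
  rcases le_total 0 (Real.log x) with h | h
  · rw [Real.posLog, max_eq_right h]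
  · rw [Real.posLog, max_eq_left h, mul_zero, Real.sqrt_zero,
      Real.sqrt_eq_zero_of_nonpos (by linarith)]

theorem tallPeaks_posLog_eq (c₀ : ℝ) (f : ℝ → ℝ) (γ : ℝ) :
    tallPeaks (fun x => √(2 * Real.posLog x)) c₀ f γ =
      {x | 0 ≤ x ∧ c₀ < x ∧ γ * √(2 * Real.log x) < |f x|} := by
  simp only [tallPeaks, sqrt_two_mul_posLog]

theorem tendsto_sqrt_two_mul_log : Tendsto (fun x => √(2 * Real.log x)) atTop atTop :=
  Real.tendsto_sqrt_atTop.comp (Real.tendsto_log_atTop.const_mul_atTop two_pos)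

/-! ### Moments and Lyapunov exponents -/

/-- The absolute moments of the solution of the linear stochastic heat equation. -/
theorem IsLinearSHESolution.integral_abs_rpow {ξ : Set (ℝ × ℝ) → Ω → ℝ}
    (hξ : IsWhiteNoise spaceTimeMeasure P ξ) {Z : ℝ → ℝ → Ω → ℝ}
    (hZ : IsLinearSHESolution P ξ Z) {t : ℝ} (ht : 0 < t) (x k : ℝ) :
    ∫ ω, |Z t x ω| ^ k ∂P =
      (Real.pi / t) ^ (-(k / 4)) * ∫ y, |y| ^ k ∂(gaussianReal 0 1) := by
  have hX := hZ.isDecorrelatingField hξ ht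
  have hκ : 0 < (Real.pi / t) ^ (1 / 4 : ℝ) := by positivity
  have hlaw := HasGaussianLaw.map_eq_of_integral (hX.gaussian x x).fst (hX.mean x)
  rw [hX.sq, Real.toNNReal_one] at hlaw
  rw [← hlaw, integral_map (hX.gaussian x x).fst.aemeasurable
    (by fun_prop : Measurable fun y : ℝ => |y| ^ k).aestronglyMeasurable, ← integral_const_mul]
  refine integral_congr_ae (ae_of_all _ fun ω => ?_)
  dsimp only
  rw [abs_mul, abs_of_pos hκ, Real.mul_rpow hκ.le (abs_nonneg _), ← Real.rpow_mul (by positivity),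
    ← mul_assoc, ← Real.rpow_add (by positivity)]
  rw [show -(k / 4) + 1 / 4 * k = 0 by ring, Real.rpow_zero, one_mul]

theorem integral_abs_rpow_gaussianReal_pos {k : ℝ} (hk : 0 < k) :
    0 < ∫ y, |y| ^ k ∂(gaussianReal 0 1) := by
  have hint : Integrable (fun y : ℝ => |y| ^ k) (gaussianReal 0 1) := by
    have := (memLp_id_gaussianReal' (μ := 0) (v := 1) (ENNReal.ofReal k)
      ENNReal.ofReal_ne_top).integrable_norm_rpow (by simpa using hk) ENNReal.ofReal_ne_top
    simpa [ENNReal.toReal_ofReal hk.le] using this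
  have hnn : ∀ y : ℝ, 0 ≤ |y| ^ k := fun y => by positivity
  rw [integral_pos_iff_support_of_nonneg hnn hint]
  have hsupp : Function.support (fun y : ℝ => |y| ^ k) = {0}ᶜ := by
    ext y
    simp [Real.rpow_eq_zero (abs_nonneg y) hk.ne']
  have := nullSingletonClass_gaussianReal (μ := 0) (v := 1) one_ne_zero
  rw [hsupp, prob_compl_eq_one_iff (measurableSet_singleton 0) |>.2 (measure_singleton 0)]
  exact one_pos

/-- Limits are unique, so any admissible exponents vanish, and strict growth already fails between k
= 2 and k = 3. -/
theorem not_isIntermittent_of_hasMomentLyapunov_zero {Z : ℝ → ℝ → Ω → ℝ}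
    (h : ∀ k, 0 < k → HasMomentLyapunov P Z 0 k 0) : ¬ IsIntermittent P Z := by
  rintro ⟨l, hl, hmono⟩
  have h0 : ∀ k, 0 < k → l k = 0 := fun k hk => tendsto_nhds_unique (hl k hk).2 (h k hk).2
  have := hmono (mem_Ici.2 (le_refl (2 : ℝ))) (mem_Ici.2 (by norm_num : (2 : ℝ) ≤ 3))
    (by norm_num)
  simp [h0] at this

/-- The moment Lyapunov exponents of the linear stochastic heat equation vanish. -/
theorem IsLinearSHESolution.hasMomentLyapunov {ξ : Set (ℝ × ℝ) → Ω → ℝ}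
    (hξ : IsWhiteNoise spaceTimeMeasure P ξ) {Z : ℝ → ℝ → Ω → ℝ}
    (hZ : IsLinearSHESolution P ξ Z) (x : ℝ) {k : ℝ} (hk : 0 < k) :
    HasMomentLyapunov P Z x k 0 := by
  have hm := integral_abs_rpow_gaussianReal_pos hk
  refine ⟨fun t ht => ⟨?_, ?_⟩, ?_⟩
  · have hG : HasGaussianLaw (Z t x) P :=
      ((hZ.mild t ht x).hasGaussianLaw_prodMk hξ (hZ.mild t ht x)).fst
    have := (hG.memLp (p := ENNReal.ofReal k) ENNReal.ofReal_ne_top).integrable_norm_rpow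
      (by simpa using hk) ENNReal.ofReal_ne_top
    simpa [ENNReal.toReal_ofReal hk.le] using this
  · rw [hZ.integral_abs_rpow hξ ht]
    have := Real.pi_pos
    positivity
  · set m := ∫ y, |y| ^ k ∂(gaussianReal 0 1)
    -- The logarithm of the moment is log m + (k/4) log(t/π), which is o(t).
    have h1 : Tendsto (fun t : ℝ => (Real.log m - k / 4 * Real.log Real.pi) * t⁻¹ +
        k / 4 * (Real.log t / t)) atTop (𝓝 0) := by
      have h2 := (tendsto_inv_atTop_zero (𝕜 := ℝ)).const_mul
        (Real.log m - k / 4 * Real.log Real.pi)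
      have h3 := (Real.isLittleO_log_id_atTop.tendsto_div_nhds_zero).const_mul (k / 4)
      simpa using h2.add h3
    refine h1.congr' ?_
    filter_upwards [eventually_gt_atTop 0] with t ht
    have hpt : 0 < Real.pi / t := by positivity
    rw [hZ.integral_abs_rpow hξ ht, Real.log_mul (by positivity) hm.ne', Real.log_rpow hpt,
      Real.log_div Real.pi_ne_zero ht.ne']
    field_simp
    ring

/-! ### Gauge function and multifractality -/

variable [IsProbabilityMeasure P] {X : ℝ → Ω → ℝ} {c K : ℝ}

/-- The peaks of a decorrelating field, measured by `√(2 log₊ x)`, have dimension `1 - γ²`. -/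
theorem IsDecorrelatingField.ae_macroDim_tallPeaks (hX : IsDecorrelatingField P X c K)
    (hc : 0 < c) (c₀ : ℝ) {γ : ℝ} (hγ : 0 < γ) (hγ1 : γ ≤ 1) :
    ∀ᵐ ω ∂P, macroDim (tallPeaks (fun x => √(2 * Real.posLog x)) c₀ (fun x => X x ω) γ) =
      ENNReal.ofReal (1 - γ ^ 2) := by
  filter_upwards [hX.ae_macroDim_le hγ.le hγ1, hX.ae_le_macroDim hc hγ (max (c₀ + 1) 0)]
    with ω h1 h2
  rw [tallPeaks_posLog_eq]
  -- Strict two-sided peaks lie between the strict one-sided peaks of the lower bound and the weak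
  -- two-sided peaks of the upper bound.
  refine le_antisymm ((macroDim_mono ?_).trans h1) (h2.trans (macroDim_mono ?_))
  · rintro x ⟨hx0, -, hx⟩
    exact ⟨hx0, hx.le⟩
  · rintro x ⟨hx0, hx⟩
    have := le_max_left (c₀ + 1) 0
    exact ⟨(le_max_right _ _).trans hx0, by linarith, hx.trans_le (le_abs_self _)⟩

/-- The limsup is at most 1 + 1/(j+1) for every j by the almost sure bound above the critical level,
and at least 1 because the critical level itself is reached at arbitrarily large x. -/
theorem IsDecorrelatingField.isGaugeFunction (hX : IsDecorrelatingField P X c K) (hc : 0 < c) :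
    IsGaugeFunction P X (fun x => √(2 * Real.posLog x)) := by
  refine ⟨fun x _ => Real.sqrt_nonneg _, ?_, ?_, ?_⟩
  · intro x hx y hy hxy
    exact Real.sqrt_le_sqrt (mul_le_mul_of_nonneg_left (Real.monotoneOn_posLog hx hy hxy)
      zero_le_two)
  · simp only [sqrt_two_mul_posLog]
    exact tendsto_sqrt_two_mul_log
  · simp only [sqrt_two_mul_posLog]
    have hup : ∀ᵐ ω ∂P, ∀ j : ℕ,
        ∀ᶠ x in atTop, |X x ω| < (1 + 1 / ((j : ℝ) + 1)) * √(2 * Real.log x) :=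
      ae_all_iff.2 fun j => hX.ae_eventually_lt (by
        have : (0 : ℝ) < 1 / ((j : ℝ) + 1) := by positivity
        linarith)
    have hpos : ∀ᶠ x in atTop, 0 < √(2 * Real.log x) :=
      tendsto_sqrt_two_mul_log.eventually_gt_atTop 0
    filter_upwards [hup, hX.ae_frequently_le hc] with ω h1 h2
    refine le_antisymm ?_ ?_
    · have hj : ∀ j : ℕ, limsup (fun x : ℝ => ((|X x ω| / √(2 * Real.log x) : ℝ) : EReal)) atTop ≤
          ((1 + 1 / ((j : ℝ) + 1) : ℝ) : EReal) := by
        intro j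
        refine limsup_le_of_le (by isBoundedDefault) ?_
        filter_upwards [h1 j, hpos] with x hx hx0
        rw [EReal.coe_le_coe_iff, div_le_iff₀ hx0]
        exact hx.le
      have ht : Tendsto (fun j : ℕ => ((1 + 1 / ((j : ℝ) + 1) : ℝ) : EReal)) atTop
          (𝓝 ((1 : ℝ) : EReal)) := by
        refine (continuous_coe_real_ereal.tendsto _).comp ?_
        simpa using (tendsto_one_div_add_atTop_nhds_zero_nat (𝕜 := ℝ)).const_add 1
      exact ge_of_tendsto' ht hj
    · refine le_limsup_of_frequently_le ?_ (by isBoundedDefault)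
      refine (h2.and_eventually hpos).mono fun x hx => ?_
      rw [← EReal.coe_one, EReal.coe_le_coe_iff, le_div_iff₀ hx.2, one_mul]
      exact hx.1.trans (le_abs_self _)

/-- Any sequence decreasing strictly inside (0, 1) serves, since 1 - γ² is strictly decreasing
there. -/
theorem IsDecorrelatingField.tallPeaksMultifractal (hX : IsDecorrelatingField P X c K)
    (hc : 0 < c) (c₀ : ℝ) :
    TallPeaksMultifractal P X (fun x => √(2 * Real.posLog x)) c₀ := by
  have hanti : StrictAnti fun i : ℕ => 1 / ((i : ℝ) + 2) := by
    intro i j hij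
    have : (i : ℝ) < j := Nat.cast_lt.2 hij
    dsimp only
    gcongr
  have hpos : ∀ i : ℕ, 0 < 1 / ((i : ℝ) + 2) := fun i => by positivity
  have hlt : ∀ i : ℕ, 1 / ((i : ℝ) + 2) < 1 := fun i => by
    rw [div_lt_one (by positivity)]; linarith [Nat.cast_nonneg (α := ℝ) i]
  refine ⟨hX.isGaugeFunction hc, fun i => 1 / ((i : ℝ) + 2), hanti, hpos, ?_⟩
  filter_upwards [ae_all_iff.2 fun i : ℕ =>
    hX.ae_macroDim_tallPeaks hc c₀ (hpos i) (hlt i).le] with ω hω i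
  rw [hω i, hω (i + 1), ENNReal.ofReal_lt_ofReal_iff]
  · have := pow_lt_pow_left₀ (hanti (Nat.lt_succ_self i)) (hpos _).le two_ne_zero
    linarith
  · have := pow_lt_one₀ (hpos (i + 1)).le (hlt _) two_ne_zero
    linarith

end Peaks


/-! ### Specialisation to the stochastic heat equation -/

theorem mainTheorem4 {Ω : Type*} [MeasurableSpace Ω] (P : Measure Ω) [IsProbabilityMeasure P]
    (ξ : Set (ℝ × ℝ) → Ω → ℝ) (hξ : IsWhiteNoise spaceTimeMeasure P ξ)
    (Z : ℝ → ℝ → Ω → ℝ) (hZ : IsLinearSHESolution P ξ Z) :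
    -- the peaks of `Z_t` at fixed `t > 0`
    (∀ t γ : ℝ, 0 < t → 0 < γ →
      (γ ≤ 1 → ∀ᵐ ω ∂P, ¬ Bornology.IsBounded (heatPeaks t (fun x => Z t x ω) γ)) ∧
      (1 < γ → ∀ᵐ ω ∂P, Bornology.IsBounded (heatPeaks t (fun x => Z t x ω) γ)) ∧
      (γ ≤ 1 → ∀ᵐ ω ∂P,
        macroDim (heatPeaks t (fun x => Z t x ω) γ) = ENNReal.ofReal (1 - γ ^ 2))) ∧
    -- the tall peaks of `X_t = (π / t)^{1/4} Z_t` in the gauge `(2 log₊ x)^{1/2}`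
    (∀ t c₀ : ℝ, 0 < t → 0 < c₀ →
      TallPeaksMultifractal P (fun x ω => (Real.pi / t) ^ (1 / 4 : ℝ) * Z t x ω)
        (fun x => √(2 * Real.posLog x)) c₀ ∧
      ∀ γ : ℝ, 0 < γ →
        (γ ≤ 1 → ∀ᵐ ω ∂P, macroDim (tallPeaks (fun x => √(2 * Real.posLog x)) c₀
          (fun x => (Real.pi / t) ^ (1 / 4 : ℝ) * Z t x ω) γ) = ENNReal.ofReal (1 - γ ^ 2)) ∧
        (1 < γ → ∀ᵐ ω ∂P, Bornology.IsBounded (tallPeaks (fun x => √(2 * Real.posLog x)) c₀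
          (fun x => (Real.pi / t) ^ (1 / 4 : ℝ) * Z t x ω) γ))) ∧
    -- `Z` is not intermittent: its moment Lyapunov exponents all vanish
    ((∀ x k : ℝ, 0 < k → HasMomentLyapunov P Z x k 0) ∧ ¬ IsIntermittent P Z) := by
  have hX := fun (t : ℝ) (ht : 0 < t) => hZ.isDecorrelatingField hξ ht
  have hc : ∀ t : ℝ, 0 < t → 0 < 1 / (4 * t) := fun t ht => by positivity
  have hlyap : ∀ x k : ℝ, 0 < k → HasMomentLyapunov P Z x k 0 := fun x k hk =>
    hZ.hasMomentLyapunov hξ x hk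
  refine ⟨fun t γ ht hγ => ⟨fun hγ1 => ?_, fun hγ1 => ?_, fun hγ1 => ?_⟩,
    fun t c₀ ht _ => ⟨(hX t ht).tallPeaksMultifractal (hc t ht) c₀, fun γ hγ =>
      ⟨fun hγ1 => (hX t ht).ae_macroDim_tallPeaks (hc t ht) c₀ hγ hγ1, fun hγ1 => ?_⟩⟩,
    hlyap, not_isIntermittent_of_hasMomentLyapunov_zero (hlyap 0)⟩
  -- Unboundedness is needed only at level 1; a smaller γ enlarges the peak set.
  · filter_upwards [(hX t ht).ae_frequently_le (hc t ht)] with ω hω hbdd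
    obtain ⟨b, hb⟩ := hbdd.bddAbove
    obtain ⟨x, hx, hxe, hxb⟩ := (hω.and_eventually ((eventually_ge_atTop
      (Real.exp (Real.exp 1))).and (eventually_gt_atTop b))).exists
    refine absurd (hb ?_) (not_le.2 hxb)
    rw [heatPeaks_eq ht]
    exact ⟨hxe, (mul_le_of_le_one_left (Real.sqrt_nonneg _) hγ1).trans hx⟩
  · filter_upwards [(hX t ht).ae_eventually_lt hγ1] with ω hω
    obtain ⟨b, hb⟩ := eventually_atTop.1 hω
    rw [heatPeaks_eq ht]
    refine (Metric.isBounded_Icc 0 b).subset ?_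
    rintro x ⟨hx, hxX⟩
    refine ⟨(Real.exp_pos _).le.trans hx, ?_⟩
    by_contra hxb
    exact absurd (hb x (not_le.1 hxb).le) (not_lt.2 (hxX.trans (le_abs_self _)))
  · filter_upwards [(hX t ht).ae_macroDim_le hγ.le hγ1,
      (hX t ht).ae_le_macroDim (hc t ht) hγ (Real.exp (Real.exp 1))] with ω h1 h2
    rw [heatPeaks_eq ht]
    refine le_antisymm ((macroDim_mono ?_).trans h1) (h2.trans (macroDim_mono ?_))
    · rintro x ⟨hx0, hx⟩
      exact ⟨(Real.exp_pos _).le.trans hx0, hx.trans (le_abs_self _)⟩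
    · rintro x ⟨hx0, hx⟩
      exact ⟨hx0, hx.le⟩
  · filter_upwards [(hX t ht).ae_eventually_lt hγ1] with ω hω
    obtain ⟨b, hb⟩ := eventually_atTop.1 hω
    rw [tallPeaks_posLog_eq]
    refine (Metric.isBounded_Icc 0 b).subset ?_
    rintro x ⟨hx, -, hxX⟩
    refine ⟨hx, ?_⟩
    by_contra hxb
    exact absurd (hb x (not_le.1 hxb).le) (not_lt.2 hxX.le)
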